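/- Let $\Phi$ be an irreducible reduced (crystallographic) root system in a Euclidean space $E$ of dimension $\ell$, with Weyl group $W$, and let $Z=\{x\in E : (\alpha,x)\in\mathbb Z \text{ for all } \alpha\in\Phi\}$ be its coweight lattice. Let $h=1+n_1+\cdots+n_\ell$ be the Coxeter number of $\Phi$, where $\tilde\alpha=n_1\alpha_1+\cdots+n_\ell\alpha_\ell$ is the highest root with respect to a base $\{\alpha_1,\dots,\alpha_\ell\}$. For a positive integer $q$, let $$M(\Phi;q)=\{x+qZ\in Z/qZ : (\beta,x)\not\equiv 0 \pmod q \text{ for all } \beta\in\Phi\},$$ on which $W$ acts by $w(x+qZ)=w(x)+qZ$, and let $\chi_{\Phi,q}:W\to\mathbb C$ be the permutation character of this action, so that $\chi_{\Phi,q}(w)$ is the number of points of $M(\Phi;q)$ fixed by $w$. Then $q\mapsto\chi_{\Phi,q}$ is a quasi-polynomial: there is a unique family of functions $\chi_{\Phi,q}:W\to\mathbb C$, $q\in\mathbb Z$, that extends the above one for $q>0$ and for which there exist an integer $n\ge1$ and polynomials $f^{(r)}_w\in\mathbb Q[t]$ ($r\in\mathbb Z/n\mathbb Z$, $w\in W$)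 such that $\chi_{\Phi,q}(w)=f^{(q\bmod n)}_w(q)$ for all $q\in\mathbb Z$ and $w\in W$. It satisfies $$\chi_{\Phi,q}(w) = (-1)^\ell\,\delta(w)\,\chi_{\Phi,h-q}(w)\qquad\text{for all } q\in\mathbb Z \text{ and } w\in W,$$ where $\delta(w)=(-1)^{\ell-r(w)}$ and $r(w)$ is the dimension of the subspace of $E$ fixed by $w$. -/

import Mathlib

noncomputable section

/-- A family `X q : A → ℂ` of functions, indexed by `q : ℤ`, is a quasi-polynomial in `q`: for some
period `n ≥ 1`, the restriction of `q ↦ X q a` to each residue class modulo `n` is a polynomial in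
`q` with rational coefficients (the constituents). -/
def IsQuasiPolynomial {A : Type*} (X : ℤ → A → ℂ) : Prop :=
  ∃ n : ℕ, 0 < n ∧ ∃ f : ZMod n → A → Polynomial ℚ,
    ∀ (q : ℤ) (a : A), X q a = Polynomial.aeval (q : ℂ) (f (q : ZMod n) a)

namespace RootPairing

variable {ι M N : Type*} [AddCommGroup M] [Module ℝ M] [AddCommGroup N] [Module ℝ N]
variable (P : RootPairing ι ℝ M N)

/-- The linear action of the Weyl group on the space `N`, on which the roots are linear functionals.
(For a root system in a Euclidean space, `N` is identified with `M` through the inner product.)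
Mathlib's `coweightEquiv` is contravariant, hence the inverse. -/
def weylAct : P.weylGroup →* (N ≃ₗ[ℝ] N) where
  toFun w := (Equiv.coweightEquiv P P (w : P.Aut)).symm
  map_one' := by
    ext x
    rw [LinearEquiv.symm_apply_eq]
    rfl
  map_mul' v w := by
    ext x
    rw [LinearEquiv.symm_apply_eq, LinearEquiv.mul_apply]
    change x = (w : P.Aut).toHom.coweightMap ((v : P.Aut).toHom.coweightMap _)
    simp

/-- A reflection in the Weyl group acts on `N` as the usual reflection `x ↦ x - α(x) α^∨`. -/
lemma weylAct_ofIdx (i : ι) (x : N) :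
    P.weylAct (weylGroup.ofIdx P i) x = x - P.toLinearMap (P.root i) x • P.coroot i := by
  have h : P.coreflection i (P.weylAct (weylGroup.ofIdx P i) x) = x :=
    LinearEquiv.apply_symm_apply (Equiv.coweightEquiv P P (Equiv.reflection P i)) x
  rw [← P.coreflection_apply, ← h, P.coreflection_same, h]

/-- The pairing of weights with `N` is invariant under the Weyl group. -/
lemma toLinearMap_weylAct (w : P.weylGroup) (m : M) (x : N) :
    P.toLinearMap ((w : P.Aut) • m) (P.weylAct w x) = P.toLinearMap m x := by
  have h := LinearMap.congr_fun (Hom.weight_coweight_transpose_apply P P (P.weylAct w x)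
    (w : P.Aut).toHom) m
  have h2 : (w : P.Aut).toHom.coweightMap (P.weylAct w x) = x :=
    Equiv.coweightMap_coweightEquiv_symm P P (w : P.Aut) x
  rw [h2] at h
  exact h

/-- The coweight lattice `Z`: the points of `N` at which all roots take integer values. -/
def coweightLattice : AddSubgroup N where
  carrier := {x | ∀ i, ∃ k : ℤ, P.toLinearMap (P.root i) x = k}
  zero_mem' i := ⟨0, by simp⟩
  add_mem' {x y} hx hy i := by
    obtain ⟨k, hk⟩ := hx i
    obtain ⟨l, hl⟩ := hy i
    exact ⟨k + l, by simp [hk, hl]⟩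
  neg_mem' {x} hx i := by
    obtain ⟨k, hk⟩ := hx i
    exact ⟨-k, by simp [hk]⟩

lemma weylAct_mem_coweightLattice (w : P.weylGroup) {x : N} (hx : x ∈ P.coweightLattice) :
    P.weylAct w x ∈ P.coweightLattice := by
  intro i
  obtain ⟨k, hk⟩ := hx ((w : P.Aut).indexEquiv.symm i)
  refine ⟨k, ?_⟩
  rw [← hk, ← P.toLinearMap_weylAct w (P.root ((w : P.Aut).indexEquiv.symm i)) x,
    ← Equiv.root_indexEquiv_eq_smul, Equiv.apply_symm_apply]

/-- The action of the Weyl group on the coweight lattice. -/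
instance : DistribMulAction P.weylGroup P.coweightLattice where
  smul w x := ⟨P.weylAct w x, P.weylAct_mem_coweightLattice w x.2⟩
  one_smul x := Subtype.ext (by change P.weylAct 1 (x : N) = x; simp)
  mul_smul v w x := Subtype.ext (by
    change P.weylAct (v * w) (x : N) = P.weylAct v (P.weylAct w x); simp)
  smul_zero w := Subtype.ext (by change P.weylAct w 0 = 0; simp)
  smul_add w x y := Subtype.ext (by
    change P.weylAct w (x + y : N) = P.weylAct w x + P.weylAct w y; simp)

/-- The sublattice `q Z` of the coweight lattice `Z`. -/
def coweightMul (q : ℕ) : AddSubgroup P.coweightLattice :=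
  (nsmulAddMonoidHom q : P.coweightLattice →+ P.coweightLattice).range

/-- The group `Z / q Z`. -/
abbrev CoweightMod (q : ℕ) : Type _ := P.coweightLattice ⧸ P.coweightMul q

/-- The action `w (π_q x) = π_q (w x)` of the Weyl group on `Z / q Z`. -/
instance (q : ℕ) : MulAction P.weylGroup (P.CoweightMod q) where
  smul w := QuotientAddGroup.map (P.coweightMul q) (P.coweightMul q)
    (DistribSMul.toAddMonoidHom P.coweightLattice w) (by
      rintro _ ⟨x, rfl⟩
      exact ⟨w • x, (map_nsmul (DistribSMul.toAddMonoidHom P.coweightLattice w) q x).symm⟩)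
  one_smul y := by
    induction y using QuotientAddGroup.induction_on with
    | H x => exact congrArg QuotientAddGroup.mk (one_smul P.weylGroup x)
  mul_smul v w y := by
    induction y using QuotientAddGroup.induction_on with
    | H x => exact congrArg QuotientAddGroup.mk (mul_smul v w x)

/-- The complement `M(Φ; q)` of the Coxeter arrangement in `Z / q Z`: the classes `π_q(x)` with
`β(x) ≢ 0 (mod q)` for all roots `β`. -/
def complement (q : ℕ) : Set (P.CoweightMod q) :=
  {y | ∃ x : P.coweightLattice, QuotientAddGroup.mk x = y ∧
    ∀ i, ¬ ∃ k : ℤ, P.toLinearMap (P.root i) (x : N) = q * k}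

/-- The complement is invariant under the Weyl group. -/
def complementSubMulAction (q : ℕ) : SubMulAction P.weylGroup (P.CoweightMod q) where
  carrier := P.complement q
  smul_mem' w y := by
    rintro ⟨x, rfl, hx⟩
    refine ⟨w • x, rfl, fun i ⟨k, hk⟩ ↦ hx ((w : P.Aut).indexEquiv.symm i) ⟨k, ?_⟩⟩
    rw [← hk, ← P.toLinearMap_weylAct w (P.root ((w : P.Aut).indexEquiv.symm i)) x,
      ← Equiv.root_indexEquiv_eq_smul, Equiv.apply_symm_apply]
    rfl

/-- The permutation character `χ_{Φ,q}` of the Weyl group on `M(Φ; q)`, for `q ≥ 1`: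
its value at `w` is the number of points of `M(Φ; q)` fixed by `w`. -/
def permChar (q : ℕ) (w : P.weylGroup) : ℂ :=
  Nat.card (MulAction.fixedBy (P.complementSubMulAction q) w)

/-- `X` is the equivariant characteristic quasi-polynomial of the root system: it is a
quasi-polynomial in `q : ℤ`, and it agrees with the permutation character on `M(Φ; q)` for every
positive integer `q`. -/
def IsEquivariantCharQuasiPoly (X : ℤ → P.weylGroup → ℂ) : Prop :=
  IsQuasiPolynomial X ∧ ∀ q : ℕ, 0 < q → ∀ w, X q w = P.permChar q w

/-- `r(w)`: the dimension of the subspace of points fixed by `w`. -/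
def fixedDim (w : P.weylGroup) : ℕ :=
  Module.finrank ℝ (LinearMap.eqLocus (P.weylAct w : N →ₗ[ℝ] N) LinearMap.id)

/-- `δ(w) = (-1)^(ℓ - r(w))`. -/
def delta (w : P.weylGroup) : ℂ :=
  (-1) ^ (Module.finrank ℝ N - P.fixedDim w)

variable {P}

/-- The Coxeter number `h = 1 + n₁ + ⋯ + n_ℓ`, where the highest root is `∑ nᵢ αᵢ`. The highest
root is the root of maximal height with respect to the base, and its height is `n₁ + ⋯ + n_ℓ`. -/
def Base.coxeterNumber (b : P.Base) : ℤ :=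
  1 + ⨆ i, b.height i

/-- If `θ = ∑ nⱼ αⱼ` is the highest root, i.e. `θ - β` is a non-negative integer combination of
simple roots for every root `β`, then the Coxeter number is `1 + ∑ nⱼ`. -/
lemma Base.coxeterNumber_eq (b : P.Base) (θ : ι) (n : ι → ℤ)
    (hn : P.root θ = ∑ j ∈ b.support, n j • P.root j)
    (hθ : ∀ i, ∃ c : ι → ℕ, P.root θ - P.root i = ∑ j ∈ b.support, c j • P.root j) :
    b.coxeterNumber = 1 + ∑ j ∈ b.support, n j := by
  have hle (i : ι) : b.height i ≤ ∑ j ∈ b.support, n j := by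
    obtain ⟨c, hc⟩ := hθ i
    have h1 : P.root i = ∑ j ∈ b.support, (n j - (c j : ℤ)) • P.root j := by
      simp only [sub_smul, Finset.sum_sub_distrib, natCast_zsmul, ← hn, ← hc]
      abel
    rw [Base.height_eq_sum h1]
    exact Finset.sum_le_sum fun j _ ↦ by omega
  have hmax : b.height θ = ∑ j ∈ b.support, n j := Base.height_eq_sum hn
  have : Nonempty ι := ⟨θ⟩
  unfold Base.coxeterNumber
  congr 1
  refine le_antisymm (ciSup_le hle) ?_
  rw [← hmax]
  exact le_ciSup (f := b.height) ⟨_, by rintro _ ⟨i, rfl⟩; exact hle i⟩ θ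

end RootPairing

end

noncomputable section

open Module

set_option linter.unusedSectionVars false

/-! ### Quasi-polynomials in one integer variable -/

section QuasiPolynomial

open Polynomial

/-! Inclusion–exclusion over sets S of roots writes χ_q(w) as the sum of (-1)^|S| N_S(q), where
N_S(q) counts the w-fixed points of Z/qZ at which all roots of S vanish. Since Z/qZ is Hom(root
lattice, ℤ/q), Smith normal form gives N_S(q) = c(q) q^d, with c periodic and even in q, and d the
dimension of the space of real points fixed by w and killed by S (`exists_card_annihilator`). Hence
χ is a quasi-polynomial, and evenness of c gives χ_{-q}(w) = ∑ (-1)^(|S|+d) N_S(q) for q > 0.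

Now sum over the fixed points y first. The inner sum, over sets S of roots vanishing at y, is by
Zaslavsky's theorem (`sum_neg_one_pow_finrank_eq_ncard_regions`) equal to (-1)^r(w) times the number
of regions that these roots cut out in the fixed space of w. A pair (y, region) amounts to a lattice
point with an adjacent alcove of the affine arrangement dilated by q, the pair being fixed by w
modulo qZ.

The Coxeter number enters through the fundamental alcove: translation by the coweight ρ on which all
simple roots are 1 maps the lattice points of the closed n-fold dilate onto those of the open
(n+h)-fold dilate (`Base.isShift_fundamentalAlcove`). Every alcove can be moved to the fundamental
one by W and Z, so each has such a shift, which is unique and therefore equivariant. Shifting the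
lattice point by the vector of its alcove identifies the pairs with the w-fixed points of M(Φ; q+h)
(`Base.card_sigma_regions`).

So χ_{-q}(w) = (-1)^r(w) χ_{q+h}(w) for q > 0. Quasi-polynomials that agree at all positive integers
are equal, so this holds for every integer q, and (-1)^r(w) = (-1)^ℓ δ(w). -/

/-- A function `ℤ → ℂ` that is given by polynomials with rational coefficients depending
periodically on the argument. -/
def IsQuasiPoly (g : ℤ → ℂ) : Prop :=
  ∃ n : ℕ, 0 < n ∧ ∃ f : ℤ → ℚ[X], Function.Periodic f (n : ℤ) ∧ ∀ q : ℤ, g q = aeval (q : ℂ) (f q)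

namespace IsQuasiPoly

variable {g g' : ℤ → ℂ}

lemma zero : IsQuasiPoly 0 := ⟨1, one_pos, 0, fun _ ↦ rfl, by simp⟩

lemma add (hg : IsQuasiPoly g) (hg' : IsQuasiPoly g') : IsQuasiPoly (g + g') := by
  obtain ⟨n, hn, f, hf, h⟩ := hg
  obtain ⟨n', hn', f', hf', h'⟩ := hg'
  refine ⟨n * n', Nat.mul_pos hn hn', f + f', ?_, by simp [h, h']⟩
  have h1 := hf.nat_mul n'
  have h2 := hf'.nat_mul n
  intro q
  have e1 := h1 q
  have e2 := h2 q
  simp only [Pi.add_apply, Nat.cast_mul]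
  rw [← e2, ← e1, mul_comm (n' : ℤ)]

lemma const_mul (hg : IsQuasiPoly g) (c : ℚ) : IsQuasiPoly (fun q ↦ (c : ℂ) * g q) := by
  obtain ⟨n, hn, f, hf, h⟩ := hg
  exact ⟨n, hn, fun q ↦ C c * f q, fun q ↦ by simp [hf q], fun q ↦ by simp [h]⟩

lemma sum {κ : Type*} (s : Finset κ) {G : κ → ℤ → ℂ} (h : ∀ k ∈ s, IsQuasiPoly (G k)) :
    IsQuasiPoly (∑ k ∈ s, G k) := by
  classical
  induction s using Finset.induction_on with
  | empty => simpa using zero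
  | insert a s ha ih =>
    rw [Finset.sum_insert ha]
    exact (h a (by simp)).add (ih fun k hk ↦ h k (by simp [hk]))

lemma comp_add (hg : IsQuasiPoly g) (m : ℤ) : IsQuasiPoly (fun q ↦ g (q + m)) := by
  obtain ⟨n, hn, f, hf, h⟩ := hg
  refine ⟨n, hn, fun q ↦ (f (q + m)).comp (X + C (m : ℚ)), fun q ↦ ?_, fun q ↦ ?_⟩
  · simp only [add_right_comm q, hf (q + m)]
  · simp [h, aeval_comp]

lemma comp_neg (hg : IsQuasiPoly g) : IsQuasiPoly (fun q ↦ g (-q)) := by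
  obtain ⟨n, hn, f, hf, h⟩ := hg
  refine ⟨n, hn, fun q ↦ (f (-q)).comp (-X), fun q ↦ ?_, fun q ↦ ?_⟩
  · have := hf (-(q + n))
    simp only at this ⊢
    rw [← this]
    congr 2
    ring
  · simp [h, aeval_comp]

lemma mul_pow {c : ℤ → ℕ} {n : ℕ} (hn : 0 < n) (hc : Function.Periodic c (n : ℤ)) (r : ℕ) :
    IsQuasiPoly (fun q ↦ (c q : ℂ) * (q : ℂ) ^ r) :=
  ⟨n, hn, fun q ↦ C (c q : ℚ) * X ^ r, fun q ↦ by simp [hc q], fun q ↦ by simp⟩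

/-- A quasi-polynomial is determined by its values at the positive integers. -/
lemma ext_of_pos (hg : IsQuasiPoly g) (hg' : IsQuasiPoly g')
    (h : ∀ q : ℕ, 0 < q → g q = g' q) : g = g' := by
  have key : IsQuasiPoly (fun q ↦ g q - g' q) := by
    convert hg.add (hg'.const_mul (-1)) using 1
    ext q
    simp [sub_eq_add_neg]
  obtain ⟨n, hn, f, hf, hgf⟩ := key
  ext q₀
  have hz : (f q₀).map (algebraMap ℚ ℂ) = 0 := by
    -- The constituent at `q₀` vanishes at all positive integers congruent to `q₀`; the offset
    -- `q₀.natAbs + 1` makes the chosen ones positive.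
    refine Polynomial.eq_zero_of_infinite_isRoot _ ?_
    refine Set.infinite_of_injective_forall_mem
      (f := fun k : ℕ ↦ ((q₀ + ((k + q₀.natAbs + 1 : ℕ) : ℤ) * n : ℤ) : ℂ)) ?_ fun k ↦ ?_
    · intro a b hab
      have hab' : q₀ + ((a + q₀.natAbs + 1 : ℕ) : ℤ) * n = q₀ + ((b + q₀.natAbs + 1 : ℕ) : ℤ) * n := by
        exact Int.cast_injective (α := ℂ) hab
      have hn0 : (n : ℤ) ≠ 0 := by exact_mod_cast hn.ne'
      have := mul_right_cancel₀ hn0 (add_left_cancel hab')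
      omega
    · set m : ℤ := q₀ + ((k + q₀.natAbs + 1 : ℕ) : ℤ) * n with hm
      have hpos : 0 < m := by
        have h1 : (1 : ℤ) ≤ n := by exact_mod_cast hn
        have h2 : ((k + q₀.natAbs + 1 : ℕ) : ℤ) ≤ ((k + q₀.natAbs + 1 : ℕ) : ℤ) * n :=
          le_mul_of_one_le_right (by positivity) h1
        omega
      have hfm : f m = f q₀ := (hf.nat_mul (k + q₀.natAbs + 1)) q₀
      obtain ⟨p, hp⟩ := Int.eq_ofNat_of_zero_le hpos.le
      have h0 : aeval (m : ℂ) (f m) = 0 := by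
        rw [← hgf m, hp, sub_eq_zero]
        exact h p (by omega)
      rw [hfm] at h0
      simpa [Set.mem_ofPred_eq, IsRoot.def, eval_map_algebraMap] using h0
  have h0 : f q₀ = 0 := by simpa [Polynomial.map_eq_zero] using hz
  have := hgf q₀
  rw [h0, map_zero] at this
  exact sub_eq_zero.mp this

end IsQuasiPoly

lemma IsQuasiPolynomial.isQuasiPoly {A : Type*} {X : ℤ → A → ℂ} (h : IsQuasiPolynomial X) (a : A) :
    IsQuasiPoly (fun q ↦ X q a) := by
  obtain ⟨n, hn, f, hf⟩ := h
  exact ⟨n, hn, fun q ↦ f q a, fun q ↦ by simp, fun q ↦ hf q a⟩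

lemma isQuasiPolynomial_of_forall {A : Type*} [Finite A] {X : ℤ → A → ℂ}
    (h : ∀ a, IsQuasiPoly (fun q ↦ X q a)) : IsQuasiPolynomial X := by
  classical
  have := Fintype.ofFinite A
  choose n hn f hf hX using h
  -- Finitely many periods have their product as a common period.
  refine ⟨∏ a, n a, Finset.prod_pos fun a _ ↦ hn a, fun r a ↦ f a (r.cast : ℤ), fun q a ↦ ?_⟩
  refine (hX a q).trans (congrArg _ ?_)
  have hd : ((∏ a, n a : ℕ) : ℤ) ∣ ((q : ZMod (∏ a, n a)).cast : ℤ) - q := by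
    rw [← ZMod.intCast_zmod_eq_zero_iff_dvd]
    simp
  obtain ⟨m, hm⟩ := (Int.natCast_dvd_natCast.mpr (Finset.dvd_prod_of_mem n (Finset.mem_univ a))).trans
    hd
  have e : ((q : ZMod (∏ a, n a)).cast : ℤ) = q + m * n a := by linarith
  beta_reduce
  rw [e]
  exact ((hf a).int_mul m q).symm

end QuasiPolynomial

/-! ### Counting homomorphisms from a lattice to `ℤ/q` -/

/-- A gcd is even and periodic in `q` when `d ≠ 0`; for `d = 0` it is `q` itself, which is the
source of the powers of `q`. -/
lemma card_zsmul_eq_zero_zmod (d : ℤ) (q : ℕ) [NeZero q] :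
    Nat.card {x : ZMod q // d • x = 0} = Int.gcd d q := by
  have h := IsAddCyclic.card_nsmulAddMonoidHom_ker (G := ZMod q) d.natAbs
  have e : {x : ZMod q // d • x = 0} ≃ (nsmulAddMonoidHom d.natAbs : ZMod q →+ ZMod q).ker :=
    Equiv.subtypeEquivRight fun x ↦ by
      rw [AddMonoidHom.mem_ker, nsmulAddMonoidHom_apply, natAbs_nsmul_eq_zero]
  rw [Nat.card_congr e, h, Nat.card_zmod, Nat.gcd_comm]
  simp [Int.gcd]

section Lattice

variable {κ F : Type*} [AddCommGroup F]

/-- A submodule of a lattice imposes diagonal conditions in a suitable basis. -/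
lemma exists_basis_diagonal [Finite κ] (bF : Basis κ ℤ F) (L : Submodule ℤ F) :
    ∃ (e : Basis κ ℤ F) (d : κ → ℤ), ∀ {A : Type} [AddCommGroup A] (φ : F →ₗ[ℤ] A),
      (∀ a ∈ L, φ a = 0) ↔ ∀ k, d k • φ (e k) = 0 := by
  classical
  obtain ⟨n, snf⟩ := L.smithNormalForm bF
  -- Basis vectors of the lattice not involved in `L` get the divisor 0, that is, no condition.
  refine ⟨snf.bM, fun k ↦ if h : ∃ i, snf.f i = k then snf.a h.choose else 0, fun φ ↦ ?_⟩
  have hval (i : Fin n) : (if h : ∃ j, snf.f j = snf.f i then snf.a h.choose else 0) = snf.a i := by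
    have h : ∃ j, snf.f j = snf.f i := ⟨i, rfl⟩
    rw [dif_pos h, snf.f.injective h.choose_spec]
  refine ⟨fun h k ↦ ?_, fun h a ha ↦ ?_⟩
  · by_cases hk : ∃ i, snf.f i = k
    · obtain ⟨i, rfl⟩ := hk
      beta_reduce
      rw [hval, ← map_smul, ← snf.snf]
      exact h _ (snf.bN i).2
    · simp [hk]
  · have hL : φ ∘ₗ L.subtype = 0 := snf.bN.ext fun i ↦ by
      have := h (snf.f i)
      beta_reduce at this
      rw [hval] at this
      simp [snf.snf, this]
    exact LinearMap.congr_fun hL ⟨a, ha⟩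

/-- Over ℝ a nonzero divisor kills its coordinate, so the free coordinates are exactly those that
contribute a factor `q` over ℤ/q. -/
lemma finrank_diagonal [Fintype κ] (d : κ → ℤ) (U : Submodule ℝ (κ → ℝ))
    (hU : ∀ g, g ∈ U ↔ ∀ k, d k • g k = 0) :
    finrank ℝ U = Nat.card {k // d k = 0} := by
  classical
  let e : U ≃ₗ[ℝ] ({k // d k = 0} → ℝ) :=
    { toFun := fun u k ↦ (u : κ → ℝ) k
      map_add' := fun _ _ ↦ rfl
      map_smul' := fun _ _ ↦ rfl
      invFun := fun g ↦ ⟨fun k ↦ if h : d k = 0 then g ⟨k, h⟩ else 0, by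
        rw [hU]
        intro k
        by_cases h : d k = 0 <;> simp [h]⟩
      left_inv := fun u ↦ by
        ext k
        have := (hU u).1 u.2 k
        by_cases h : d k = 0
        · simp [h]
        · simp only [h, dite_false]
          exact ((smul_eq_zero.mp this).resolve_left h).symm
      right_inv := fun g ↦ by
        ext k
        simp [k.2] }
  rw [e.finrank_eq, Module.finrank_fintype_fun_eq_card, Nat.card_eq_fintype_card]

/-- The number of homomorphisms from a lattice to `ℤ/q` that vanish on a given subgroup is
`c(q) q ^ r` with `c` even and periodic, where `r` is the dimension of the corresponding real
space. -/
theorem exists_card_annihilator [Finite κ] {V : Type*} [AddCommGroup V] [Module ℝ V]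
    (bF : Basis κ ℤ F) (ε : V ≃ₗ[ℝ] (F →ₗ[ℤ] ℝ)) (L : Submodule ℤ F) (U : Submodule ℝ V)
    (hU : ∀ v, v ∈ U ↔ ∀ a ∈ L, ε v a = 0) :
    ∃ n : ℕ, 0 < n ∧ ∃ c : ℤ → ℕ, Function.Periodic c (n : ℤ) ∧ (∀ q, c (-q) = c q) ∧
      ∀ q : ℕ, 0 < q →
        Nat.card {φ : F →ₗ[ℤ] ZMod q // ∀ a ∈ L, φ a = 0} = c q * q ^ finrank ℝ U := by
  classical
  have := Fintype.ofFinite κ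
  obtain ⟨e, d, hd⟩ := exists_basis_diagonal bF L
  have hr : finrank ℝ U = Nat.card {k // d k = 0} := by
    let E : V ≃ₗ[ℝ] (κ → ℝ) := ε.trans (e.constr ℝ).symm
    rw [← finrank_diagonal d (U.map (E : V →ₗ[ℝ] (κ → ℝ))) fun g ↦ ?_]
    · exact (LinearEquiv.finrank_map_eq E U).symm
    · obtain ⟨v, rfl⟩ := E.surjective g
      rw [Submodule.mem_map_equiv, LinearEquiv.symm_apply_apply, hU, hd]
      simp [E, Basis.constr]
  set Nz := Finset.univ.filter fun k ↦ d k ≠ 0 with hNz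
  refine ⟨∏ k ∈ Nz, (d k).natAbs, Finset.prod_pos fun k hk ↦ ?_,
    fun q ↦ ∏ k ∈ Nz, Int.gcd (d k) q, fun q ↦ ?_, fun q ↦ by simp, fun q hq ↦ ?_⟩
  · simpa [hNz, Int.natAbs_pos] using hk
  · refine Finset.prod_congr rfl fun k hk ↦ ?_
    obtain ⟨m, hm⟩ : d k ∣ ((∏ k ∈ Nz, (d k).natAbs : ℕ) : ℤ) :=
      Int.natAbs_dvd.mp (Int.natCast_dvd_natCast.mpr (Finset.dvd_prod_of_mem _ hk))
    rw [hm]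
    simp
  · have : NeZero q := ⟨hq.ne'⟩
    have E : {φ : F →ₗ[ℤ] ZMod q // ∀ a ∈ L, φ a = 0} ≃ (∀ k, {x : ZMod q // d k • x = 0}) :=
      ((e.constr ℤ).symm.toEquiv.subtypeEquiv (p := fun φ ↦ ∀ a ∈ L, φ a = 0)
        (q := fun g ↦ ∀ k, d k • g k = 0) fun φ ↦ by rw [hd]; simp [Basis.constr]).trans
        (Equiv.subtypePiEquivPi (p := fun k x ↦ d k • x = 0))
    rw [Nat.card_congr E, Nat.card_pi]
    simp_rw [card_zsmul_eq_zero_zmod]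
    rw [← Finset.prod_filter_mul_prod_filter_not Finset.univ (fun k ↦ d k ≠ 0), hr]
    congr 1
    rw [Finset.prod_congr rfl (g := fun _ ↦ q) fun k hk ↦ ?_, Finset.prod_const,
      Nat.card_eq_fintype_card, Fintype.card_subtype]
    · simp
    · have : d k = 0 := by simpa using hk
      simp [this]

end Lattice

/-! ### Regions of central arrangements -/

section Regions

variable {ι V : Type*} [AddCommGroup V] [Module ℝ V] (f : ι → Dual ℝ V)

/-- The regions of the arrangement of the hyperplanes `f j = 0`, `j ∈ J`, in a subspace `U`, each
encoded by the set of those `j ∈ J` for which `f j` is positive on it. -/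
def regions (U : Submodule ℝ V) (J : Finset ι) : Set (Finset ι) :=
  {s | s ⊆ J ∧ ∃ u ∈ U, ∀ j ∈ J, f j u ≠ 0 ∧ (j ∈ s ↔ 0 < f j u)}

lemma finite_regions (U : Submodule ℝ V) (J : Finset ι) : (regions f U J).Finite :=
  J.powerset.finite_toSet.subset fun _ hs ↦ Finset.mem_coe.mpr (Finset.mem_powerset.mpr hs.1)

/-- Finitely many strict inequalities survive a small move in any direction. -/
lemma exists_pos_forall_sign_add (J : Finset ι) {u : V} (v : V) (hu : ∀ j ∈ J, f j u ≠ 0) :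
    ∃ t : ℝ, 0 < t ∧ ∀ j ∈ J, f j (u + t • v) ≠ 0 ∧ (0 < f j (u + t • v) ↔ 0 < f j u) := by
  have h : ∀ᶠ t : ℝ in nhdsWithin 0 (Set.Ioi 0), ∀ j ∈ J,
      f j (u + t • v) ≠ 0 ∧ (0 < f j (u + t • v) ↔ 0 < f j u) := by
    rw [Filter.eventually_all_finset]
    intro j hj
    refine Filter.Eventually.filter_mono nhdsWithin_le_nhds ?_
    have hc : Filter.Tendsto (fun t : ℝ ↦ f j (u + t • v)) (nhds 0) (nhds (f j u)) := by
      have : Continuous (fun t : ℝ ↦ f j (u + t • v)) := by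
        simp only [map_add, map_smul, smul_eq_mul]
        fun_prop
      simpa using this.tendsto 0
    rcases (hu j hj).lt_or_gt with h | h
    · filter_upwards [hc.eventually_lt_const h] with t ht
      exact ⟨ht.ne, by constructor <;> intro <;> linarith⟩
    · filter_upwards [hc.eventually_const_lt h] with t ht
      exact ⟨ht.ne', iff_of_true ht h⟩
  obtain ⟨t, ht, ht0⟩ := (h.and self_mem_nhdsWithin).exists
  exact ⟨t, ht0, ht⟩

variable [DecidableEq ι]

lemma regions_insert_of_notMem {U : Submodule ℝ V} {J : Finset ι} {j : ι} (hj : j ∉ J)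
    {s : Finset ι} (hs : s ⊆ J) :
    s ∈ regions f U (insert j J) ↔
      ∃ u ∈ U, f j u < 0 ∧ ∀ i ∈ J, f i u ≠ 0 ∧ (i ∈ s ↔ 0 < f i u) := by
  have hjs : j ∉ s := fun h ↦ hj (hs h)
  constructor
  · rintro ⟨-, u, hu, h⟩
    have h1 := h j (by simp)
    refine ⟨u, hu, lt_of_le_of_ne (not_lt.mp fun h' ↦ hjs (h1.2.2 h')) h1.1, fun i hi ↦
      h i (by simp [hi])⟩
  · rintro ⟨u, hu, h1, h⟩
    refine ⟨hs.trans (Finset.subset_insert _ _), u, hu, fun i hi ↦ ?_⟩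
    rcases Finset.mem_insert.mp hi with rfl | hi
    · exact ⟨h1.ne, by simp [hjs, h1.le]⟩
    · exact h i hi

lemma insert_mem_regions_insert {U : Submodule ℝ V} {J : Finset ι} {j : ι} (hj : j ∉ J)
    {s : Finset ι} (hs : s ⊆ J) :
    insert j s ∈ regions f U (insert j J) ↔
      ∃ u ∈ U, 0 < f j u ∧ ∀ i ∈ J, f i u ≠ 0 ∧ (i ∈ s ↔ 0 < f i u) := by
  constructor
  · rintro ⟨-, u, hu, h⟩
    refine ⟨u, hu, (h j (by simp)).2.1 (by simp), fun i hi ↦ ?_⟩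
    have hij : i ≠ j := fun h ↦ hj (h ▸ hi)
    simpa [hij] using h i (by simp [hi])
  · rintro ⟨u, hu, h1, h⟩
    refine ⟨Finset.insert_subset_insert _ hs, u, hu, fun i hi ↦ ?_⟩
    rcases Finset.mem_insert.mp hi with rfl | hi
    · exact ⟨h1.ne', by simp [h1]⟩
    · have hij : i ≠ j := fun h ↦ hj (h ▸ hi)
      simpa [hij] using h i hi

/-- Deletion and restriction for the number of regions. -/
lemma ncard_regions_insert {U : Submodule ℝ V} {J : Finset ι} {j : ι} (hj : j ∉ J)
    {v : V} (hv : v ∈ U) (hfv : f j v ≠ 0) :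
    (regions f U (insert j J)).ncard =
      (regions f U J).ncard + (regions f (U ⊓ LinearMap.ker (f j)) J).ncard := by
  obtain ⟨v, hv, hfv⟩ : ∃ v ∈ U, 0 < f j v := by
    rcases hfv.lt_or_gt with h | h
    · exact ⟨-v, U.neg_mem hv, by simpa using h⟩
    · exact ⟨v, hv, h⟩
  -- `Am` and `Ap` are the regions for `J` that meet the negative and the positive side of the new
  -- hyperplane. Their union is all regions for `J`, and their intersection consists of the regions
  -- cut by the hyperplane, that is, the regions of the restriction.
  set Am : Set (Finset ι) := {s | s ⊆ J ∧ s ∈ regions f U (insert j J)} with hAm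
  set Ap : Set (Finset ι) := {s | s ⊆ J ∧ insert j s ∈ regions f U (insert j J)} with hAp
  have fin (A : Set (Finset ι)) (h : ∀ s ∈ A, s ⊆ J) : A.Finite :=
    J.powerset.finite_toSet.subset fun s hs ↦ Finset.mem_coe.mpr (Finset.mem_powerset.mpr (h s hs))
  have hAmf : Am.Finite := fin _ fun s hs ↦ hs.1
  have hApf : Ap.Finite := fin _ fun s hs ↦ hs.1
  have hunion : Am ∪ Ap = regions f U J := by
    ext s
    constructor
    · rintro (⟨hs, h⟩ | ⟨hs, h⟩)
      · obtain ⟨u, hu, -, h⟩ := (regions_insert_of_notMem f hj hs).1 h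
        exact ⟨hs, u, hu, h⟩
      · obtain ⟨u, hu, -, h⟩ := (insert_mem_regions_insert f hj hs).1 h
        exact ⟨hs, u, hu, h⟩
    · rintro ⟨hs, u, hu, h⟩
      rcases lt_trichotomy (f j u) 0 with h0 | h0 | h0
      · exact Or.inl ⟨hs, (regions_insert_of_notMem f hj hs).2 ⟨u, hu, h0, h⟩⟩
      · obtain ⟨t, ht, ht'⟩ := exists_pos_forall_sign_add f J v fun i hi ↦ (h i hi).1
        refine Or.inr ⟨hs, (insert_mem_regions_insert f hj hs).2
          ⟨u + t • v, U.add_mem hu (U.smul_mem _ hv), by simp [h0, ht, hfv], fun i hi ↦ ?_⟩⟩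
        exact ⟨(ht' i hi).1, (h i hi).2.trans (ht' i hi).2.symm⟩
      · exact Or.inr ⟨hs, (insert_mem_regions_insert f hj hs).2 ⟨u, hu, h0, h⟩⟩
  have hinter : Am ∩ Ap = regions f (U ⊓ LinearMap.ker (f j)) J := by
    ext s
    constructor
    · rintro ⟨⟨hs, h⟩, ⟨-, h'⟩⟩
      obtain ⟨u, hu, hju, h⟩ := (regions_insert_of_notMem f hj hs).1 h
      obtain ⟨u', hu', hju', h'⟩ := (insert_mem_regions_insert f hj hs).1 h'
      -- The two points lie in one convex region on opposite sides; this positive combination lies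
      -- on the hyperplane `f j = 0`.
      refine ⟨hs, f j u' • u + (-f j u) • u', ⟨U.add_mem (U.smul_mem _ hu) (U.smul_mem _ hu'), ?_⟩,
        fun i hi ↦ ?_⟩
      · simp [LinearMap.mem_ker]; ring
      · obtain ⟨a1, a2⟩ := h i hi
        obtain ⟨b1, b2⟩ := h' i hi
        simp only [map_add, map_smul, smul_eq_mul]
        by_cases his : i ∈ s
        · have p1 := mul_pos hju' (a2.1 his)
          have p2 := mul_pos (neg_pos.mpr hju) (b2.1 his)
          exact ⟨by linarith, by simp only [his, true_iff]; linarith⟩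
        · have q1 : f i u < 0 := lt_of_le_of_ne (not_lt.mp fun h ↦ his (a2.2 h)) a1
          have q2 : f i u' < 0 := lt_of_le_of_ne (not_lt.mp fun h ↦ his (b2.2 h)) b1
          have p1 := mul_neg_of_pos_of_neg hju' q1
          have p2 := mul_neg_of_pos_of_neg (neg_pos.mpr hju) q2
          exact ⟨by linarith, by simp only [his, false_iff]; linarith⟩
    · rintro ⟨hs, u, ⟨hu, hju⟩, h⟩
      rw [SetLike.mem_coe, LinearMap.mem_ker] at hju
      obtain ⟨t, ht, ht'⟩ := exists_pos_forall_sign_add f J v fun i hi ↦ (h i hi).1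
      obtain ⟨t₂, ht₂, ht₂'⟩ := exists_pos_forall_sign_add f J (-v) fun i hi ↦ (h i hi).1
      refine ⟨⟨hs, (regions_insert_of_notMem f hj hs).2
        ⟨u + t₂ • -v, U.add_mem hu (U.smul_mem _ (U.neg_mem hv)), by simp [hju, ht₂, hfv],
          fun i hi ↦ ?_⟩⟩, hs, (insert_mem_regions_insert f hj hs).2
          ⟨u + t • v, U.add_mem hu (U.smul_mem _ hv), by simp [hju, ht, hfv], fun i hi ↦ ?_⟩⟩
      · exact ⟨(ht₂' i hi).1, (h i hi).2.trans (ht₂' i hi).2.symm⟩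
      · exact ⟨(ht' i hi).1, (h i hi).2.trans (ht' i hi).2.symm⟩
  have hsplit : regions f U (insert j J) = Am ∪ (insert j '' Ap) := by
    ext s
    constructor
    · intro h
      by_cases hjs : j ∈ s
      · refine Or.inr ⟨s.erase j, ⟨?_, by rwa [Finset.insert_erase hjs]⟩, Finset.insert_erase hjs⟩
        rw [← Finset.subset_insert_iff]
        exact h.1
      · exact Or.inl ⟨(Finset.subset_insert_iff_of_notMem hjs).1 h.1, h⟩
    · rintro (h | ⟨s, h, rfl⟩)
      · exact h.2
      · exact h.2
  have hdisj : Disjoint Am (insert j '' Ap) := by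
    rw [Set.disjoint_left]
    rintro _ h ⟨s, -, rfl⟩
    exact hj (h.1 (Finset.mem_insert_self j s))
  have hinj : Set.InjOn (insert j) Ap := by
    intro s hs s' hs' h
    have h1 : j ∉ s := fun h ↦ hj (hs.1 h)
    have h2 : j ∉ s' := fun h ↦ hj (hs'.1 h)
    rw [← Finset.erase_insert h1, ← Finset.erase_insert h2, h]
  rw [hsplit, Set.ncard_union_eq hdisj hAmf (hApf.image _), hinj.ncard_image,
    ← hunion, ← hinter, Set.ncard_union_add_ncard_inter _ _ hAmf hApf]

/-- Zaslavsky's theorem: the alternating sum over all subfamilies of a central arrangement counts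
its regions. -/
theorem sum_neg_one_pow_finrank_eq_ncard_regions [FiniteDimensional ℝ V] (J : Finset ι)
    (U : Submodule ℝ V) :
    ∑ S ∈ J.powerset, (-1 : ℤ) ^ S.card *
        (-1) ^ finrank ℝ (U ⊓ ⨅ j ∈ S, LinearMap.ker (f j) : Submodule ℝ V) =
      (-1) ^ finrank ℝ U * (regions f U J).ncard := by
  induction J using Finset.induction_on generalizing U with
  | empty =>
    have : regions f U ∅ = {∅} := by
      ext s
      simp only [regions, Finset.subset_empty, Set.mem_ofPred_eq, Set.mem_singleton_iff]
      exact ⟨fun h ↦ h.1, fun h ↦ ⟨h, 0, U.zero_mem, by simp⟩⟩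
    have h : (U ⊓ ⨅ j ∈ (∅ : Finset ι), LinearMap.ker (f j)) = U := by simp
    rw [Finset.powerset_empty, Finset.sum_singleton, h, this]
    simp
  | insert j J hj ih =>
    rw [Finset.sum_powerset_insert hj]
    have hstep : ∀ S ∈ J.powerset, (-1 : ℤ) ^ (insert j S).card *
        (-1) ^ finrank ℝ (U ⊓ ⨅ i ∈ insert j S, LinearMap.ker (f i) : Submodule ℝ V) =
        -((-1 : ℤ) ^ S.card * (-1) ^ finrank ℝ
          ((U ⊓ LinearMap.ker (f j)) ⊓ ⨅ i ∈ S, LinearMap.ker (f i) : Submodule ℝ V)) := by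
      intro S hS
      have hjS : j ∉ S := fun h ↦ hj (Finset.mem_powerset.mp hS h)
      rw [Finset.card_insert_of_notMem hjS, Finset.iInf_insert, inf_assoc, pow_succ]
      ring
    rw [Finset.sum_congr rfl hstep, Finset.sum_neg_distrib, ih, ih]
    -- If `f j` vanishes on `U`, there are no regions and the two halves of the sum cancel;
    -- otherwise the restriction drops the dimension by one and deletion–restriction applies.
    by_cases hz : ∀ v ∈ U, f j v = 0
    · have h1 : U ⊓ LinearMap.ker (f j) = U := inf_eq_left.mpr fun v hv ↦ hz v hv
      have h2 : regions f U (insert j J) = ∅ := by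
        rw [Set.eq_empty_iff_forall_notMem]
        rintro s ⟨-, u, hu, h⟩
        exact (h j (by simp)).1 (hz u hu)
      rw [h1, h2]
      simp
    · push Not at hz
      obtain ⟨v, hv, hfv⟩ := hz
      have hdim : finrank ℝ (U ⊓ LinearMap.ker (f j) : Submodule ℝ V) + 1 = finrank ℝ U := by
        have hne : (f j).domRestrict U ≠ 0 := fun h ↦
          hfv (by simpa using LinearMap.congr_fun h ⟨v, hv⟩)
        have h1 := Module.Dual.finrank_ker_add_one_of_ne_zero hne
        rw [LinearMap.ker_domRestrict] at h1
        have h2 := LinearEquiv.finrank_eq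
          (Submodule.comapSubtypeEquivOfLe (inf_le_left : U ⊓ LinearMap.ker (f j) ≤ U))
        rw [Submodule.comap_inf, Submodule.comap_subtype_self, top_inf_eq] at h2
        rw [← h1, h2]
      rw [ncard_regions_insert f hj hv hfv, ← hdim, pow_succ]
      push_cast
      ring

end Regions

/-! ### The highest root -/

namespace RootPairing.Base

variable {ι M N : Type*} [Finite ι] [AddCommGroup M] [Module ℝ M] [AddCommGroup N] [Module ℝ N]
  {P : RootPairing ι ℝ M N} [P.IsCrystallographic] (b : P.Base)

/-- A root that is of maximal height among the roots above it. -/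
def IsMaximalRoot (θ : ι) : Prop :=
  ∀ k, P.root k - P.root θ ∈ AddSubmonoid.closure (P.root '' b.support) → b.height k ≤ b.height θ

variable {b}

lemma root_mem_closure_of_isPos {i : ι} (h : b.IsPos i) :
    P.root i ∈ AddSubmonoid.closure (P.root '' b.support) :=
  h.induction_on_add (p := fun i ↦ P.root i ∈ AddSubmonoid.closure (P.root '' b.support))
    (fun i hi ↦ AddSubmonoid.subset_closure ⟨i, hi, rfl⟩)
    fun _ j _ hk hi hj ↦ hk ▸ add_mem hi (AddSubmonoid.subset_closure ⟨j, hj, rfl⟩)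

variable (b) in
lemma exists_isMaximalRoot_ge (i : ι) : ∃ θ, b.IsMaximalRoot θ ∧
    P.root θ - P.root i ∈ AddSubmonoid.closure (P.root '' b.support) := by
  obtain ⟨θ, hθ, hmax⟩ := Set.exists_max_image
    {k | P.root k - P.root i ∈ AddSubmonoid.closure (P.root '' b.support)} b.height
    (Set.toFinite _) ⟨i, by simp⟩
  refine ⟨θ, fun k hk ↦ hmax k ?_, hθ⟩
  simpa using add_mem hk hθ

namespace IsMaximalRoot

variable {θ θ' : ι}

/-- Were θ negative, -θ would lie above it, with larger height. -/
lemma isPos (h : b.IsMaximalRoot θ) : b.IsPos θ := by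
  let := P.indexNeg
  by_contra hneg
  have hpos := (IsPos.neg_iff_not b θ).2 hneg
  have h1 := root_mem_closure_of_isPos hpos
  have h2 := h (-θ) (by
    have := add_mem h1 h1
    simpa [sub_eq_add_neg] using this)
  rw [isPos_iff] at hneg hpos
  omega

/-- A negative pairing would make θ + α_j a root, higher than θ. -/
lemma pairingIn_nonneg (h : b.IsMaximalRoot θ) {j : ι} (hj : j ∈ b.support) :
    0 ≤ P.pairingIn ℤ θ j := by
  by_contra! hneg
  have hne : P.root θ ≠ -P.root j := by
    intro hθ
    let := P.indexNeg
    have : θ = -j := P.root.injective (by simp [hθ])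
    have h1 := isPos_iff b |>.1 h.isPos
    rw [this, height_reflectionPerm_self, height_one_of_mem_support hj] at h1
    omega
  obtain ⟨k, hk⟩ := P.root_add_root_mem_of_pairingIn_neg hneg hne
  have h1 := h k (by
    rw [hk, add_sub_cancel_left]
    exact AddSubmonoid.subset_closure ⟨j, hj, rfl⟩)
  rw [b.height_add hk, height_one_of_mem_support hj] at h1
  omega

lemma exists_coeff_nonneg (h : b.IsPos θ) : ∃ f : ι → ℤ, (∀ j, 0 ≤ f j) ∧
    P.root θ = ∑ j ∈ b.support, f j • P.root j := by
  obtain ⟨f, -, hf | hf, h'⟩ := b.exists_root_eq_sum_int θ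
  · exact ⟨f, hf.le, h'⟩
  · rw [isPos_iff, height_eq_sum h'] at h
    exact absurd h (not_lt.mpr (Finset.sum_nonpos fun j _ ↦ hf.le j))

lemma pairingIn_eq_sum {f : ι → ℤ} (h : P.root θ = ∑ j ∈ b.support, f j • P.root j) (i : ι) :
    P.pairingIn ℤ θ i = ∑ j ∈ b.support, f j * P.pairingIn ℤ j i := by
  apply FaithfulSMul.algebraMap_injective ℤ ℝ
  simp_rw [algebraMap_pairingIn, map_sum, map_mul, algebraMap_pairingIn, ← root_coroot_eq_pairing,
    h, map_sum, map_zsmul, LinearMap.coe_sum, Finset.sum_apply, LinearMap.smul_apply, zsmul_eq_mul]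
  rfl

variable [P.IsReduced] [P.IsIrreducible]

/-- All coefficients of a maximal root are positive. -/
lemma coeff_pos (h : b.IsMaximalRoot θ) {f : ι → ℤ} (hf : ∀ j, 0 ≤ f j)
    (hθ : P.root θ = ∑ j ∈ b.support, f j • P.root j) {j : ι} (hj : j ∈ b.support) : 0 < f j := by
  by_contra hj0
  -- The span of the simple roots occurring in θ is stable under all simple reflections, hence is
  -- everything by irreducibility. A missing simple root would then contradict linear independence
  -- of the base.
  set J : Set ι := {i | i ∈ b.support ∧ 0 < f i} with hJ
  set W : Submodule ℝ M := Submodule.span ℝ (P.root '' J) with hW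
  have hW_bot : W ≠ ⊥ := by
    intro hbot
    apply P.ne_zero θ
    rw [hθ]
    refine Finset.sum_eq_zero fun i hi ↦ ?_
    rcases (hf i).eq_or_lt with h0 | h0
    · simp [← h0]
    · have : P.root i ∈ W := Submodule.subset_span ⟨i, ⟨hi, h0⟩, rfl⟩
      rw [hbot, Submodule.mem_bot] at this
      exact absurd this (P.ne_zero i)
  have hinv : ∀ i ∈ b.support, W ∈ Module.End.invtSubmodule (P.reflection i) := by
    intro i hi
    rw [Module.End.mem_invtSubmodule, hW, Submodule.span_le]
    rintro _ ⟨k, ⟨hk, hk0⟩, rfl⟩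
    rw [SetLike.mem_coe, Submodule.mem_comap]
    by_cases hi0 : 0 < f i
    · change P.reflection i (P.root k) ∈ _
      rw [P.reflection_apply_root]
      exact Submodule.sub_mem _ (Submodule.subset_span ⟨k, ⟨hk, hk0⟩, rfl⟩)
        (Submodule.smul_mem _ _ (Submodule.subset_span ⟨i, ⟨hi, hi0⟩, rfl⟩))
    · have hfi : f i = 0 := le_antisymm (not_lt.mp hi0) (hf i)
      -- The pairing of θ with a missing simple coroot is nonnegative by maximality but a sum of
      -- nonpositive terms, so every occurring simple root is orthogonal to the missing one.
      have hle : ∀ l ∈ b.support, f l * P.pairingIn ℤ l i ≤ 0 := by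
        intro l hl
        rcases eq_or_ne l i with rfl | hli
        · simp [hfi]
        · exact mul_nonpos_of_nonneg_of_nonpos (hf l) (b.pairingIn_le_zero_of_ne hli hl hi)
      have hsum : ∑ l ∈ b.support, f l * P.pairingIn ℤ l i = 0 :=
        le_antisymm (Finset.sum_nonpos hle)
          (by rw [← pairingIn_eq_sum hθ]; exact h.pairingIn_nonneg hi)
      have hzero := (Finset.sum_eq_zero_iff_of_nonpos hle).1 hsum k hk
      have hpair : P.pairing k i = 0 := by
        rw [← P.algebraMap_pairingIn ℤ, (mul_eq_zero.mp hzero).resolve_left hk0.ne', map_zero]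
      change P.reflection i (P.root k) ∈ _
      rw [P.reflection_apply_root, hpair, zero_smul, sub_zero]
      exact Submodule.subset_span ⟨k, ⟨hk, hk0⟩, rfl⟩
  have htop := IsIrreducible.eq_top_of_invtSubmodule_reflection (P := P) W
    ((b.forall_mem_support_invtSubmodule_iff W).1 hinv) hW_bot
  have hmem : P.root j ∈ Submodule.span ℝ (P.root '' J) := by
    rw [← hW, htop]; trivial
  refine LinearIndepOn.notMem_span_of_insert (b.linearIndepOn_root.mono ?_) (fun h ↦ hj0 h.2) hmem
  exact Set.insert_subset hj fun i hi ↦ hi.1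

/-- Two distinct maximal roots have positive pairing, because all coefficients of θ' are positive
and θ pairs nonnegatively with every simple root, positively with one. So θ' - θ is a root;
whichever its sign, one of the two lies strictly above the other. -/
lemma unique (h : b.IsMaximalRoot θ) (h' : b.IsMaximalRoot θ') : θ' = θ := by
  by_contra hne
  obtain ⟨f, hf, hf'⟩ := exists_coeff_nonneg h'.isPos
  have hnn : ∀ j ∈ b.support, 0 ≤ P.pairingIn ℤ j θ := fun j hj ↦ by
    by_contra! hneg
    have h1 := h.pairingIn_nonneg hj
    rcases h1.eq_or_lt with h0 | h0
    · have := P.pairingIn_eq_zero_iff.1 h0.symm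
      omega
    · have := (P.zero_lt_pairingIn_iff' ℤ).1 h0
      omega
  obtain ⟨i, hi, hi0⟩ := h.isPos.exists_mem_support_pos_pairingIn
  have hpos : 0 < P.pairingIn ℤ θ' θ := by
    rw [pairingIn_eq_sum hf']
    exact Finset.sum_pos' (fun j hj ↦ mul_nonneg (hf j) (hnn j hj))
      ⟨i, hi, mul_pos (h'.coeff_pos hf hf' hi) hi0⟩
  obtain ⟨k, hk⟩ := P.root_sub_root_mem_of_pairingIn_pos hpos hne
  let := P.indexNeg
  have hht := b.height_sub hk
  rcases IsPos.or_neg b k with hkp | hkp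
  · have h1 := h θ' (hk ▸ root_mem_closure_of_isPos hkp)
    rw [isPos_iff] at hkp
    omega
  · have h2 := root_mem_closure_of_isPos hkp
    have e : P.root (-k) = -P.root k := by simp
    have h1 := h' θ (by rwa [e, hk, neg_sub] at h2)
    rw [isPos_iff, height_reflectionPerm_self] at hkp
    omega

end IsMaximalRoot

variable (b) in
/-- The highest root of an irreducible root system. -/
theorem exists_highest_root [P.IsReduced] [P.IsIrreducible] [Nonempty ι] : ∃ θ, ∀ i,
    P.root θ - P.root i ∈ AddSubmonoid.closure (P.root '' b.support) := by
  obtain ⟨θ, hθ, -⟩ := b.exists_isMaximalRoot_ge (Classical.arbitrary ι)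
  refine ⟨θ, fun i ↦ ?_⟩
  obtain ⟨θ', hθ', h⟩ := b.exists_isMaximalRoot_ge i
  rwa [hθ.unique hθ'] at h

end RootPairing.Base

/-! ### Integer values of the roots on the coweight lattice -/

namespace RootPairing

variable {ι M N : Type*} [AddCommGroup M] [Module ℝ M] [AddCommGroup N] [Module ℝ N]
  (P : RootPairing ι ℝ M N)

/-- The permutation of the roots given by an element of the Weyl group. -/
abbrev weylPerm (w : P.weylGroup) : ι ≃ ι := (w : P.Aut).indexEquiv

/-- The integer value of a root at a point of the coweight lattice. -/
def rootVal (i : ι) : P.coweightLattice →+ ℤ where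
  toFun x := (x.2 i).choose
  map_zero' := by
    have h : P.root' i 0 = (((0 : P.coweightLattice).2 i).choose : ℝ) :=
      ((0 : P.coweightLattice).2 i).choose_spec
    rw [map_zero] at h
    exact_mod_cast h.symm
  map_add' x y := by
    have h : P.root' i (x + y) = (((x + y).2 i).choose : ℝ) := ((x + y).2 i).choose_spec
    rw [map_add, (x.2 i).choose_spec, (y.2 i).choose_spec] at h
    exact_mod_cast h.symm

lemma coe_rootVal (i : ι) (x : P.coweightLattice) : (P.rootVal i x : ℝ) = P.root' i (x : N) :=
  ((x.2 i).choose_spec).symm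

lemma rootVal_neg (i : ι) (x : P.coweightLattice) :
    letI := P.indexNeg
    P.rootVal (-i) x = -P.rootVal i x := by
  let := P.indexNeg
  have : (P.rootVal (-i) x : ℝ) = -P.rootVal i x := by
    rw [coe_rootVal, coe_rootVal]; simp [root']
  exact_mod_cast this

lemma root'_weylPerm_weylAct (w : P.weylGroup) (i : ι) (v : N) :
    P.root' (P.weylPerm w i) (P.weylAct w v) = P.root' i v := by
  rw [← P.toLinearMap_weylAct w (P.root i) v, ← Equiv.root_indexEquiv_eq_smul]

lemma coe_smul_coweightLattice (w : P.weylGroup) (x : P.coweightLattice) :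
    ((w • x : P.coweightLattice) : N) = P.weylAct w x := rfl

lemma rootVal_weylPerm_smul (w : P.weylGroup) (i : ι) (x : P.coweightLattice) :
    P.rootVal (P.weylPerm w i) (w • x) = P.rootVal i x := by
  have h := P.root'_weylPerm_weylAct w i x
  rw [← coe_smul_coweightLattice, ← coe_rootVal, ← coe_rootVal] at h
  exact_mod_cast h

lemma rootVal_inv_smul (w : P.weylGroup) (i : ι) (x : P.coweightLattice) :
    P.rootVal i (w⁻¹ • x) = P.rootVal (P.weylPerm w i) x := by
  rw [← P.rootVal_weylPerm_smul w, smul_inv_smul]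

section RootSystem

variable [P.IsRootSystem]

lemma eq_zero_of_forall_root'_eq_zero {v : N} (h : ∀ i, P.root' i v = 0) : v = 0 :=
  (P.flip.eq_zero_iff_forall_coroot'_eq_zero (x := v)).2 h

lemma rootVal_ext {x y : P.coweightLattice} (h : ∀ i, P.rootVal i x = P.rootVal i y) : x = y := by
  refine Subtype.ext (sub_eq_zero.mp (P.eq_zero_of_forall_root'_eq_zero fun i ↦ ?_))
  rw [map_sub, ← coe_rootVal, ← coe_rootVal, h, sub_self]

instance finite_weylGroup [Finite ι] : Finite P.weylGroup := by
  refine Finite.of_injective (fun w : P.weylGroup ↦ P.weylPerm w) fun w w' h ↦ ?_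
  refine Subtype.ext (Equiv.weightHom_injective P (LinearEquiv.toLinearMap_injective ?_))
  refine LinearMap.ext_on (s := Set.range P.root) IsRootSystem.span_root_eq_top ?_
  rintro _ ⟨i, rfl⟩
  change (w : P.Aut) • P.root i = (w' : P.Aut) • P.root i
  rw [← Equiv.root_indexEquiv_eq_smul, ← Equiv.root_indexEquiv_eq_smul]
  exact congrArg P.root (Equiv.congr_fun h i)

end RootSystem

/-! ### Moving points by the affine Weyl group -/

section Reflection

variable [Fintype ι]

/-- Follows from reindexing the sum by the reflection s_i. It expresses the inner product of the
coroot with `v`, for the W-invariant form ∑ α_j², through α_i(v). -/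
lemma two_mul_sum_pairing_mul_root' (i : ι) (v : N) :
    2 * ∑ j, P.pairing j i * P.root' j v = P.root' i v * ∑ j, P.pairing j i ^ 2 := by
  have h : ∑ j, P.pairing j i * P.root' j v =
      ∑ j, -(P.pairing j i * (P.root' j v - P.pairing j i * P.root' i v)) := by
    rw [← Equiv.sum_comp (P.reflectionPerm i)]
    refine Finset.sum_congr rfl fun j _ ↦ ?_
    have h1 : P.pairing (P.reflectionPerm i j) i = -P.pairing j i := by
      rw [← P.pairing_reflectionPerm, P.pairing_reflectionPerm_self_right]
    have h2 : P.root' (P.reflectionPerm i j) v = P.root' j v - P.pairing j i * P.root' i v := by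
      simp [root', P.reflection_apply_root]
    rw [h1, h2]
    ring
  have h3 : ∑ j, -(P.pairing j i * (P.root' j v - P.pairing j i * P.root' i v)) =
      -∑ j, P.pairing j i * P.root' j v + P.root' i v * ∑ j, P.pairing j i ^ 2 := by
    rw [Finset.mul_sum, ← Finset.sum_neg_distrib, ← Finset.sum_add_distrib]
    exact Finset.sum_congr rfl fun j _ ↦ by ring
  linarith

/-- Reflecting a point in a hyperplane that separates it from `p₀` brings it closer to `p₀`. -/
lemma sum_sq_root'_reflection_lt (i : ι) (m : ℝ) (p p₀ : N)
    (h : (P.root' i p - m) * (P.root' i p₀ - m) < 0) :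
    ∑ j, P.root' j (p - (P.root' i p - m) • P.coroot i - p₀) ^ 2 < ∑ j, P.root' j (p - p₀) ^ 2 := by
  set c := P.root' i p - m with hc
  have e : ∑ j, P.root' j (p - c • P.coroot i - p₀) ^ 2 = ∑ j, P.root' j (p - p₀) ^ 2 -
      c * (2 * ∑ j, P.pairing j i * P.root' j (p - p₀)) + c ^ 2 * ∑ j, P.pairing j i ^ 2 := by
    simp only [Finset.mul_sum]
    rw [← Finset.sum_sub_distrib, ← Finset.sum_add_distrib]
    refine Finset.sum_congr rfl fun j _ ↦ ?_
    have : p - c • P.coroot i - p₀ = (p - p₀) - c • P.coroot i := by abel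
    rw [this, map_sub, map_smul, P.root'_coroot_eq_pairing, smul_eq_mul]
    ring
  have hpos : 0 < ∑ j, P.pairing j i ^ 2 :=
    Finset.sum_pos' (fun j _ ↦ sq_nonneg _) ⟨i, Finset.mem_univ i, by simp⟩
  have h2 : P.root' i (p - p₀) = c - (P.root' i p₀ - m) := by rw [map_sub, hc]; ring
  rw [e, P.two_mul_sum_pairing_mul_root', h2]
  -- The squared distance changes by (α_i(p) - m)(α_i(p₀) - m) ∑ ⟨α_j, α_i^∨⟩², which is negative.
  nlinarith [mul_neg_of_neg_of_pos h hpos]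

end Reflection

lemma coroot_mem_coweightLattice [P.IsCrystallographic] (i : ι) :
    P.coroot i ∈ P.coweightLattice := fun j ↦
  ⟨P.pairingIn ℤ j i, by
    rw [P.root_coroot_eq_pairing, ← P.algebraMap_pairingIn ℤ]; rfl⟩

section Finite

variable [Finite ι] [P.IsRootSystem]

lemma finite_setOf_abs_rootVal_le (B : ℤ) :
    {z : P.coweightLattice | ∀ i, |P.rootVal i z| ≤ B}.Finite := by
  refine Set.Finite.of_injOn (f := fun z i ↦ P.rootVal i z)
    (t := Set.pi Set.univ fun _ : ι ↦ Set.Icc (-B) B) ?_ ?_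
    (Set.Finite.pi fun _ ↦ Set.finite_Icc _ _)
  · exact fun z hz i _ ↦ abs_le.mp (hz i)
  · exact fun z _ z' _ h ↦ P.rootVal_ext fun i ↦ congrFun h i

/-- Every point can be moved, by the Weyl group and by translations from the coweight lattice, to
a point that no affine root hyperplane separates from a given one. -/
lemma exists_smul_add_not_separated [P.IsCrystallographic] (p p₀ : N) :
    ∃ (w : P.weylGroup) (z : P.coweightLattice), ∀ (i : ι) (m : ℤ),
      0 ≤ (P.root' i (P.weylAct w p + z) - m) * (P.root' i p₀ - m) := by
  have := Fintype.ofFinite ι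
  have := Fintype.ofFinite P.weylGroup
  let D : P.weylGroup × P.coweightLattice → ℝ := fun g ↦
    ∑ j, P.root' j (P.weylAct g.1 p + g.2 - p₀) ^ 2
  -- Bounded distance bounds every integer α_i(z), and W is finite; hence a closest point to `p₀` in
  -- the orbit exists.
  have hfin : {g | D g ≤ D (1, 0)}.Finite := by
    obtain ⟨B, hB⟩ := exists_int_gt
      (1 + D (1, 0) + ∑ w : P.weylGroup, ∑ i, |P.root' i (P.weylAct w p - p₀)|)
    refine (Set.finite_univ.prod (P.finite_setOf_abs_rootVal_le B)).subset fun g hg ↦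
      ⟨trivial, fun i ↦ ?_⟩
    have h1 : P.root' i (P.weylAct g.1 p + g.2 - p₀) ^ 2 ≤ D (1, 0) :=
      (Finset.single_le_sum (f := fun j ↦ P.root' j (P.weylAct g.1 p + g.2 - p₀) ^ 2)
        (fun j _ ↦ sq_nonneg _) (Finset.mem_univ i)).trans hg
    have h2 : |P.root' i (P.weylAct g.1 p - p₀)| ≤
        ∑ w : P.weylGroup, ∑ i, |P.root' i (P.weylAct w p - p₀)| :=
      (Finset.single_le_sum (f := fun i ↦ |P.root' i (P.weylAct g.1 p - p₀)|)
        (fun j _ ↦ abs_nonneg _) (Finset.mem_univ i)).trans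
      (Finset.single_le_sum (f := fun w ↦ ∑ i, |P.root' i (P.weylAct w p - p₀)|)
        (fun j _ ↦ Finset.sum_nonneg fun _ _ ↦ abs_nonneg _) (Finset.mem_univ g.1))
    have h3 : (P.rootVal i g.2 : ℝ) =
        P.root' i (P.weylAct g.1 p + g.2 - p₀) - P.root' i (P.weylAct g.1 p - p₀) := by
      rw [← map_sub, coe_rootVal]
      congr 1
      abel
    have h4 : |P.root' i (P.weylAct g.1 p + g.2 - p₀)| ≤
        1 + P.root' i (P.weylAct g.1 p + g.2 - p₀) ^ 2 := by
      rw [abs_le]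
      constructor <;> nlinarith
    have h5 := abs_sub (P.root' i (P.weylAct g.1 p + g.2 - p₀)) (P.root' i (P.weylAct g.1 p - p₀))
    rw [← h3] at h5
    have h6 : (|P.rootVal i g.2| : ℝ) ≤ B := by linarith
    exact_mod_cast h6
  obtain ⟨⟨w, z⟩, hg, hmin⟩ := Set.exists_min_image _ D hfin ⟨(1, 0), le_refl (D (1, 0))⟩
  refine ⟨w, z, fun i m ↦ ?_⟩
  by_contra! hneg
  have hlt := P.sum_sq_root'_reflection_lt i m _ _ hneg
  -- Compose with the affine reflection in α_i = m, whose translation part is m times a coroot; the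
  -- result would be closer to `p₀`.
  set g' : P.weylGroup × P.coweightLattice := (weylGroup.ofIdx P i * w,
    weylGroup.ofIdx P i • z + m • ⟨P.coroot i, P.coroot_mem_coweightLattice i⟩) with hg'
  have hpt : P.weylAct g'.1 p + g'.2 =
      P.weylAct w p + z - (P.root' i (P.weylAct w p + z) - m) • P.coroot i := by
    have e1 : P.weylAct g'.1 p = P.weylAct (weylGroup.ofIdx P i) (P.weylAct w p) := by
      rw [hg', map_mul]; rfl
    have e2 : (g'.2 : N) = P.weylAct (weylGroup.ofIdx P i) z + (m : ℝ) • P.coroot i := by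
      rw [hg', AddSubgroup.coe_add, coe_smul_coweightLattice, AddSubgroup.coe_zsmul,
        Int.cast_smul_eq_zsmul]
    rw [e1, e2, ← add_assoc, ← map_add, P.weylAct_ofIdx, sub_smul]
    abel
  have hlt' : D g' < D (w, z) := by
    simp only [D, hpt]
    exact hlt
  exact absurd (hmin g' (hlt'.le.trans hg)) (not_le.mpr hlt')

end Finite

/-! ### Alcoves -/

/-- The alcoves: a function `k` describes the set of the points `p` with
`k i < α_i(p) < k i + 1` for all roots `α_i`, provided that this set is not empty. -/
def IsAlcove (k : ι → ℤ) : Prop :=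
  ∃ p : N, ∀ i, (k i : ℝ) < P.root' i p ∧ P.root' i p < k i + 1

/-- Translation by `ρ` maps the lattice points of the closed alcove `k`, dilated by `n`, onto those
of the open alcove, dilated by `n + h`. -/
def IsShift (h : ℤ) (k : ι → ℤ) (ρ : P.coweightLattice) : Prop :=
  ∀ (n : ℕ) (x : P.coweightLattice),
    (∀ i, n * k i ≤ P.rootVal i x ∧ P.rootVal i x ≤ n * (k i + 1)) ↔
      ∀ i, (n + h) * k i < P.rootVal i (x + ρ) ∧ P.rootVal i (x + ρ) < (n + h) * (k i + 1)

variable {P} in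
-- Take n = 0: the closed alcove dilated by 0 is the origin, so the open alcove dilated by h
-- contains a single lattice point, the shift.
lemma IsShift.unique [P.IsRootSystem] {h : ℤ} {k : ι → ℤ} {ρ ρ' : P.coweightLattice}
    (hρ : P.IsShift h k ρ) (hρ' : P.IsShift h k ρ') : ρ' = ρ := by
  have h1 := (hρ' 0 0).1 (by simp)
  have h2 := (hρ 0 (ρ' - ρ)).2 (by simpa using h1)
  refine P.rootVal_ext fun i ↦ ?_
  have h3 := h2 i
  simp only [map_sub] at h3
  push_cast at h3
  omega

variable {P} in
/-- Shifts are compatible with the extended affine Weyl group. -/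
lemma IsShift.of_smul_add {h : ℤ} {k k' : ι → ℤ} {ρ : P.coweightLattice} (w : P.weylGroup)
    (z : P.coweightLattice)
    (hk : ∀ i, k' (P.weylPerm w i) = k i + P.rootVal (P.weylPerm w i) z)
    (hρ : P.IsShift h k' ρ) : P.IsShift h k (w⁻¹ • (ρ - h • z)) := by
  intro n x
  -- The map v ↦ wv + z between alcoves becomes v ↦ wv + nz on n-fold dilates and v ↦ wv + (n+h)z on
  -- (n+h)-fold ones; the discrepancy `h • z` goes into the shift.
  have key := hρ n (w • x + n • z)
  rw [(P.weylPerm w).surjective.forall, (P.weylPerm w).surjective.forall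
    (p := fun i ↦ (n + h) * k' i < P.rootVal i (w • x + n • z + ρ) ∧
      P.rootVal i (w • x + n • z + ρ) < (n + h) * (k' i + 1))] at key
  refine Iff.trans (forall_congr' fun i ↦ ?_) (key.trans (forall_congr' fun i ↦ ?_))
  · simp only [map_add, map_nsmul, rootVal_weylPerm_smul, hk, nsmul_eq_mul, mul_add]
    constructor <;> rintro ⟨h1, h2⟩ <;> constructor <;> linarith
  · simp only [map_add, map_nsmul, rootVal_weylPerm_smul, hk, smul_eq_mul, nsmul_eq_mul, mul_add,
      rootVal_inv_smul, map_sub, map_zsmul, add_mul]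
    constructor <;> rintro ⟨h1, h2⟩ <;> constructor <;> linarith

variable {P} in
lemma IsShift.eq_smul_add [P.IsRootSystem] {h : ℤ} {k k' : ι → ℤ} {ρ ρ' : P.coweightLattice}
    (w : P.weylGroup) (z : P.coweightLattice)
    (hk : ∀ i, k' (P.weylPerm w i) = k i + P.rootVal (P.weylPerm w i) z)
    (hρ : P.IsShift h k ρ) (hρ' : P.IsShift h k' ρ') : ρ' = w • ρ + h • z := by
  rw [(hρ'.of_smul_add w z hk).unique hρ, smul_inv_smul, sub_add_cancel]

/-! ### The fundamental alcove -/

section Base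

variable {P} [P.IsRootSystem] (b : P.Base)

lemma Base.exists_forall_root'_eq (c : b.support → ℝ) :
    ∃ v : N, ∀ j : b.support, P.root' j v = c j := by
  refine ⟨P.flip.toPerfPair.symm (b.toWeightBasis.constr ℝ c), fun j ↦ ?_⟩
  have h : P.flip.toPerfPair (P.flip.toPerfPair.symm (b.toWeightBasis.constr ℝ c)) (P.root j) =
      c j := by
    rw [LinearEquiv.apply_symm_apply, ← b.toWeightBasis_apply, Basis.constr_basis]
  exact h

/-- This is the coweight on which every simple root is 1; it shifts the fundamental alcove. -/
lemma Base.exists_rootVal_eq_height :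
    ∃ ρ : P.coweightLattice, ∀ i, P.rootVal i ρ = b.height i := by
  obtain ⟨v, hv⟩ := b.exists_forall_root'_eq 1
  have h (i : ι) : P.root' i v = b.height i := by
    obtain ⟨f, -, -, hf⟩ := b.exists_root_eq_sum_int i
    rw [Base.height_eq_sum hf, root', hf]
    simp only [map_sum, map_zsmul, LinearMap.coe_sum, Finset.sum_apply, LinearMap.smul_apply]
    push_cast
    refine Finset.sum_congr rfl fun j hj ↦ ?_
    have := hv ⟨j, hj⟩
    simp only [root', Pi.one_apply] at this
    rw [this]
    simp
  refine ⟨⟨v, fun i ↦ ⟨b.height i, h i⟩⟩, fun i ↦ ?_⟩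
  have := P.coe_rootVal i ⟨v, fun i ↦ ⟨b.height i, h i⟩⟩
  rw [h] at this
  exact_mod_cast this

variable [Finite ι] [P.IsCrystallographic]

lemma Base.rootVal_le_of_sub_mem_closure {b : P.Base} {i j : ι} {x : P.coweightLattice}
    (hx : ∀ l ∈ b.support, 0 ≤ P.rootVal l x)
    (h : P.root j - P.root i ∈ AddSubmonoid.closure (P.root '' b.support)) :
    P.rootVal i x ≤ P.rootVal j x := by
  have key : ∀ m ∈ AddSubmonoid.closure (P.root '' b.support), 0 ≤ P.toLinearMap m (x : N) := by
    intro m hm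
    induction hm using AddSubmonoid.closure_induction with
    | mem m hm =>
      obtain ⟨l, hl, rfl⟩ := hm
      have := P.coe_rootVal l x
      rw [root'] at this
      rw [← this]
      exact_mod_cast hx l hl
    | zero => simp
    | add m m' _ _ h h' => rw [map_add, LinearMap.add_apply]; positivity
  have h1 := key _ h
  rw [map_sub, LinearMap.sub_apply, sub_nonneg] at h1
  have h2 := P.coe_rootVal i x
  have h3 := P.coe_rootVal j x
  rw [root'] at h2 h3
  rw [← h2, ← h3] at h1
  exact_mod_cast h1

lemma Base.rootVal_nonneg_of_isPos {b : P.Base} {i : ι} (hi : b.IsPos i) {x : P.coweightLattice}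
    (hx : ∀ l ∈ b.support, 0 ≤ P.rootVal l x) : 0 ≤ P.rootVal i x := by
  let := P.indexNeg
  have h := Base.root_mem_closure_of_isPos hi
  have e : P.root i - P.root (-i) = P.root i + P.root i := by simp
  have h1 := rootVal_le_of_sub_mem_closure hx (e ▸ add_mem h h)
  have h2 := P.rootVal_neg i x
  omega

variable [P.IsReduced] [P.IsIrreducible]

lemma Base.nonempty_index (P : RootPairing ι ℝ M N) [P.IsRootSystem] [P.IsIrreducible] :
    Nonempty ι := by
  by_contra hne
  rw [not_nonempty_iff] at hne
  have := IsIrreducible.nontrivial P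
  have h : Submodule.span ℝ (Set.range P.root) = ⊤ := IsRootSystem.span_root_eq_top
  rw [Set.range_eq_empty, Submodule.span_empty] at h
  exact bot_ne_top h

lemma Base.exists_highest_root_coxeterNumber : ∃ θ, b.coxeterNumber = 1 + b.height θ ∧
    ∀ i, P.root θ - P.root i ∈ AddSubmonoid.closure (P.root '' b.support) := by
  have := Base.nonempty_index P
  obtain ⟨θ, hθ⟩ := b.exists_highest_root
  obtain ⟨ρ, hρ⟩ := b.exists_rootVal_eq_height
  have hle (i : ι) : b.height i ≤ b.height θ := by
    rw [← hρ, ← hρ]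
    refine rootVal_le_of_sub_mem_closure (fun l hl ↦ ?_) (hθ i)
    rw [hρ, height_one_of_mem_support hl]
    exact zero_le_one
  refine ⟨θ, ?_, hθ⟩
  unfold Base.coxeterNumber
  congr 1
  exact le_antisymm (ciSup_le hle) (le_ciSup (f := b.height) ⟨_, by rintro _ ⟨i, rfl⟩; exact hle i⟩ θ)

lemma Base.height_lt_coxeterNumber (i : ι) : b.height i < b.coxeterNumber := by
  unfold Base.coxeterNumber
  have : b.height i ≤ ⨆ i, b.height i := le_ciSup (Set.finite_range b.height).bddAbove i
  omega

lemma Base.neg_coxeterNumber_lt_height (i : ι) : -b.coxeterNumber < b.height i := by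
  let := P.indexNeg
  have := b.height_lt_coxeterNumber (-i)
  rw [b.height_reflectionPerm_self] at this
  omega

lemma Base.coxeterNumber_pos : 0 < b.coxeterNumber := by
  obtain ⟨i⟩ := Base.nonempty_index P
  have h1 := b.height_lt_coxeterNumber i
  have h2 := b.neg_coxeterNumber_lt_height i
  omega

open Classical in
/-- The fundamental alcove. -/
def Base.fundamentalAlcove (i : ι) : ℤ := if b.IsPos i then 0 else -1

/-- Positive roots have heights between 1 and h - 1, so adding ρ makes the closed inequalities
strict. Conversely, by integrality, α(x) + 1 > 0 gives α(x) ≥ 0 for simple α, and θ(x) + h - 1 < n +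
h gives θ(x) ≤ n; these bound all other roots because θ is highest. -/
lemma Base.isShift_fundamentalAlcove {ρ : P.coweightLattice}
    (hρ : ∀ i, P.rootVal i ρ = b.height i) :
    P.IsShift b.coxeterNumber b.fundamentalAlcove ρ := by
  obtain ⟨θ, hθ, hmax⟩ := b.exists_highest_root_coxeterNumber
  let := P.indexNeg
  intro n x
  simp only [map_add, hρ, fundamentalAlcove]
  constructor
  · intro h i
    have h1 := h i
    have h2 := b.height_lt_coxeterNumber i
    have h3 := b.neg_coxeterNumber_lt_height i
    by_cases hi : b.IsPos i
    · have := b.isPos_iff.1 hi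
      simp only [hi, if_true] at h1 ⊢
      constructor <;> linarith
    · have := mt b.isPos_iff'.2 hi
      simp only [hi, if_false] at h1 ⊢
      constructor <;> linarith
  · intro h
    have hsimple : ∀ l ∈ b.support, 0 ≤ P.rootVal l x := by
      intro l hl
      have h1 := h l
      simp only [isPos_of_mem_support hl, if_true, height_one_of_mem_support hl] at h1
      omega
    have hθx : P.rootVal θ x ≤ n := by
      have h1 := (h θ).2
      by_cases hp : b.IsPos θ
      · simp only [hp, if_true] at h1
        linarith
      · simp only [hp, if_false] at h1
        have := b.height_lt_coxeterNumber θ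
        have := mt b.isPos_iff'.2 hp
        have h3 := b.neg_coxeterNumber_lt_height θ
        omega
    have hpos (i : ι) (hi : b.IsPos i) : 0 ≤ P.rootVal i x ∧ P.rootVal i x ≤ n :=
      ⟨rootVal_nonneg_of_isPos hi hsimple,
        (rootVal_le_of_sub_mem_closure hsimple (hmax i)).trans hθx⟩
    intro i
    by_cases hi : b.IsPos i
    · simp only [hi, if_true]
      have := hpos i hi
      constructor <;> linarith
    · simp only [hi, if_false]
      have := hpos (-i) ((Base.IsPos.neg_iff_not b i).2 hi)
      rw [P.rootVal_neg] at this
      constructor <;> linarith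

/-- Every alcove has a shift for the Coxeter number. -/
theorem Base.exists_isShift {k : ι → ℤ} (hk : P.IsAlcove k) :
    ∃ ρ, P.IsShift b.coxeterNumber k ρ := by
  obtain ⟨ρ, hρ⟩ := b.exists_rootVal_eq_height
  obtain ⟨p, hp⟩ := hk
  have hpos : (0 : ℝ) < b.coxeterNumber := by exact_mod_cast b.coxeterNumber_pos
  -- ρ/h is an interior point of the fundamental alcove.
  set p₀ : N := (b.coxeterNumber : ℝ)⁻¹ • (ρ : N) with hp₀
  have hcell (i : ι) : (b.fundamentalAlcove i : ℝ) < P.root' i p₀ ∧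
      P.root' i p₀ < b.fundamentalAlcove i + 1 := by
    have h1 : (b.height i : ℝ) < b.coxeterNumber := by exact_mod_cast b.height_lt_coxeterNumber i
    have h2 : -(b.coxeterNumber : ℝ) < b.height i := by
      exact_mod_cast b.neg_coxeterNumber_lt_height i
    have e : P.root' i p₀ = b.height i / b.coxeterNumber := by
      rw [hp₀, map_smul, ← coe_rootVal, hρ, smul_eq_mul, inv_mul_eq_div]
    rw [e, lt_div_iff₀ hpos, div_lt_iff₀ hpos, fundamentalAlcove]
    by_cases hi : b.IsPos i
    · have : (0 : ℝ) < b.height i := by exact_mod_cast b.isPos_iff.1 hi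
      simp only [hi, if_true]
      push_cast
      constructor <;> linarith
    · have : (b.height i : ℝ) < 0 := by exact_mod_cast not_le.mp (mt b.isPos_iff'.2 hi)
      simp only [hi, if_false]
      push_cast
      constructor <;> linarith
  obtain ⟨w, z, hwz⟩ := P.exists_smul_add_not_separated p p₀
  refine ⟨_, (b.isShift_fundamentalAlcove hρ).of_smul_add w z fun i ↦ ?_⟩
  have e : P.root' (P.weylPerm w i) (P.weylAct w p + z) =
      P.root' i p + P.rootVal (P.weylPerm w i) z := by
    rw [map_add, P.root'_weylPerm_weylAct, coe_rootVal]
  have hpi := hp i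
  have hci := hcell (P.weylPerm w i)
  have hsep := hwz (P.weylPerm w i)
  rw [e] at hsep
  set r := P.rootVal (P.weylPerm w i) z
  set a := b.fundamentalAlcove (P.weylPerm w i)
  -- If the moved point lay in another strip for this root, the wall at the larger of the two
  -- integers would separate it from `p₀`.
  rcases lt_trichotomy a (k i + r) with hlt | heq | hlt
  · have h1 := hsep (k i + r)
    have h2 : (a : ℝ) + 1 ≤ k i + r := by exact_mod_cast hlt
    push_cast at h1
    nlinarith
  · exact heq
  · have h1 := hsep a
    have h2 : (k i : ℝ) + r + 1 ≤ a := by exact_mod_cast hlt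
    nlinarith

end Base

end RootPairing

/-! ### The values of the roots on `Z / q Z` -/

namespace RootPairing

variable {ι M N : Type*} [AddCommGroup M] [Module ℝ M] [AddCommGroup N] [Module ℝ N]
  (P : RootPairing ι ℝ M N)

/-- The value modulo `q` of a root on `Z / q Z`. -/
def rootRes (q : ℕ) (i : ι) : P.CoweightMod q →+ ZMod q :=
  QuotientAddGroup.lift (P.coweightMul q) ((Int.castAddHom (ZMod q)).comp (P.rootVal i)) (by
    rintro _ ⟨x, rfl⟩
    simp)

@[simp] lemma rootRes_mk (q : ℕ) (i : ι) (x : P.coweightLattice) :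
    P.rootRes q i (QuotientAddGroup.mk x) = (P.rootVal i x : ZMod q) := rfl

lemma rootRes_mk_eq_zero_iff {q : ℕ} {i : ι} {x : P.coweightLattice} :
    P.rootRes q i (QuotientAddGroup.mk x) = 0 ↔ (q : ℤ) ∣ P.rootVal i x := by
  rw [rootRes_mk, ZMod.intCast_zmod_eq_zero_iff_dvd]

lemma rootRes_weylPerm_smul (q : ℕ) (w : P.weylGroup) (i : ι) (y : P.CoweightMod q) :
    P.rootRes q (P.weylPerm w i) (w • y) = P.rootRes q i y := by
  induction y using QuotientAddGroup.induction_on with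
  | H x =>
    change P.rootRes q (P.weylPerm w i) (QuotientAddGroup.mk (w • x)) = _
    rw [rootRes_mk, rootVal_weylPerm_smul, rootRes_mk]

lemma mem_complement_iff {q : ℕ} {y : P.CoweightMod q} :
    y ∈ P.complement q ↔ ∀ i, P.rootRes q i y ≠ 0 := by
  have key (x : P.coweightLattice) (i : ι) : P.rootRes q i (QuotientAddGroup.mk x) = 0 ↔
      ∃ k : ℤ, P.toLinearMap (P.root i) (x : N) = q * k := by
    rw [rootRes_mk_eq_zero_iff]
    refine exists_congr fun k ↦ ?_
    have h := P.coe_rootVal i x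
    rw [root'] at h
    rw [← h]
    norm_cast
  constructor
  · rintro ⟨x, rfl, hx⟩ i h
    exact hx i ((key x i).1 h)
  · intro h
    induction y using QuotientAddGroup.induction_on with
    | H x => exact ⟨x, rfl, fun i hi ↦ h i ((key x i).2 hi)⟩

lemma mk_eq_mk_iff {q : ℕ} {x x' : P.coweightLattice} :
    (QuotientAddGroup.mk x : P.CoweightMod q) = QuotientAddGroup.mk x' ↔ ∃ z, x' = x + q • z := by
  rw [QuotientAddGroup.eq]
  refine exists_congr fun z ↦ ?_
  rw [nsmulAddMonoidHom_apply, eq_neg_add_iff_add_eq, eq_comm]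

section RootSystem

variable [P.IsRootSystem]

/-- If all roots take values divisible by q on x' - x, then (x' - x)/q is again in the coweight
lattice. -/
lemma rootRes_ext {q : ℕ} (hq : 0 < q) {y y' : P.CoweightMod q}
    (h : ∀ i, P.rootRes q i y = P.rootRes q i y') : y = y' := by
  induction y using QuotientAddGroup.induction_on with
  | H x =>
  induction y' using QuotientAddGroup.induction_on with
  | H x' =>
  have hd (i : ι) : ∃ k : ℤ, P.rootVal i x' - P.rootVal i x = q * k := by
    have := h i
    rw [rootRes_mk, rootRes_mk] at this
    exact (ZMod.intCast_eq_intCast_iff_dvd_sub _ _ _).1 this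
  have hq' : (q : ℝ) ≠ 0 := by exact_mod_cast hq.ne'
  refine P.mk_eq_mk_iff.2 ⟨⟨(q : ℝ)⁻¹ • ((x' : N) - x), fun i ↦ ?_⟩, ?_⟩
  · obtain ⟨k, hk⟩ := hd i
    refine ⟨k, ?_⟩
    have hk' : (P.rootVal i x' : ℝ) - P.rootVal i x = q * k := by exact_mod_cast hk
    rw [coe_rootVal, coe_rootVal] at hk'
    rw [map_smul, map_sub, hk', smul_eq_mul, inv_mul_cancel_left₀ hq']
  · apply Subtype.ext
    rw [AddSubgroup.coe_add, AddSubgroup.coe_nsmul, ← Nat.cast_smul_eq_nsmul ℝ,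
      smul_inv_smul₀ hq', add_sub_cancel]

lemma finite_coweightMod [Finite ι] {q : ℕ} (hq : 0 < q) : Finite (P.CoweightMod q) := by
  have : NeZero q := ⟨hq.ne'⟩
  exact Finite.of_injective (fun y i ↦ P.rootRes q i y)
    fun y y' h ↦ P.rootRes_ext hq fun i ↦ congrFun h i

lemma smul_eq_self_iff {q : ℕ} (hq : 0 < q) {w : P.weylGroup} {y : P.CoweightMod q} :
    w • y = y ↔ ∀ i, P.rootRes q (P.weylPerm w i) y = P.rootRes q i y := by
  constructor
  · intro h i
    conv_lhs => rw [← h]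
    exact P.rootRes_weylPerm_smul q w i y
  · intro h
    refine P.rootRes_ext hq fun i ↦ ?_
    obtain ⟨i, rfl⟩ := (P.weylPerm w).surjective i
    rw [rootRes_weylPerm_smul, h]

/-- The subspace of the fixed points of an element of the Weyl group. -/
def fixedSpace (w : P.weylGroup) : Submodule ℝ N :=
  LinearMap.eqLocus (P.weylAct w : N →ₗ[ℝ] N) LinearMap.id

lemma mem_fixedSpace_iff {w : P.weylGroup} {v : N} : v ∈ P.fixedSpace w ↔ P.weylAct w v = v :=
  Iff.rfl

lemma mem_fixedSpace_iff_forall {w : P.weylGroup} {v : N} :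
    v ∈ P.fixedSpace w ↔ ∀ i, P.root' (P.weylPerm w i) v = P.root' i v := by
  rw [mem_fixedSpace_iff]
  constructor
  · intro h i
    conv_lhs => rw [← h]
    exact P.root'_weylPerm_weylAct w i v
  · intro h
    refine sub_eq_zero.mp (P.eq_zero_of_forall_root'_eq_zero fun i ↦ ?_)
    obtain ⟨i, rfl⟩ := (P.weylPerm w).surjective i
    rw [map_sub, P.root'_weylPerm_weylAct, h, sub_self]

end RootSystem

/-! ### Points of `Z / q Z` as homomorphisms on the root lattice -/

section Base

variable {P} [P.IsRootSystem] (b : P.Base)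

/-- The space `N` is the space of real functionals on the root lattice. -/
def Base.realEquiv : N ≃ₗ[ℝ] (P.rootSpan ℤ →ₗ[ℤ] ℝ) :=
  (P.flip.toPerfPair.trans (b.toWeightBasis.constr ℝ).symm).trans (b.toWeightBasisInt.constr ℝ)

lemma Base.realEquiv_apply (v : N) (a : P.rootSpan ℤ) :
    b.realEquiv v a = P.toLinearMap (a : M) v := by
  let g : P.rootSpan ℤ →ₗ[ℤ] ℝ :=
    { toFun := fun a ↦ P.toLinearMap (a : M) v
      map_add' := by simp
      map_smul' := by simp }
  have h : b.realEquiv v = g := b.toWeightBasisInt.ext fun j ↦ by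
    simp only [Base.realEquiv, LinearEquiv.trans_apply, Basis.constr_basis]
    change P.toLinearMap (b.toWeightBasis j) v = P.toLinearMap (b.toWeightBasisInt j : M) v
    simp
  rw [h]
  rfl

/-- A point of `Z / q Z` as a homomorphism from the root lattice to `ℤ/q`. -/
def Base.residueHom (q : ℕ) (y : P.CoweightMod q) : P.rootSpan ℤ →ₗ[ℤ] ZMod q :=
  b.toWeightBasisInt.constr ℤ fun j ↦ P.rootRes q j y

lemma rootVal_eq_sum {f : ι → ℤ} {i : ι} (hf : P.root i = ∑ j ∈ b.support, f j • P.root j)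
    (x : P.coweightLattice) : P.rootVal i x = ∑ j ∈ b.support, f j * P.rootVal j x := by
  have : (P.rootVal i x : ℝ) = ∑ j ∈ b.support, (f j : ℝ) * (P.rootVal j x : ℝ) := by
    simp_rw [coe_rootVal, root', hf]
    simp
  exact_mod_cast this

lemma Base.residueHom_rootSpanMem (q : ℕ) (y : P.CoweightMod q) (i : ι) :
    b.residueHom q y (P.rootSpanMem ℤ i) = P.rootRes q i y := by
  obtain ⟨f, -, -, hf⟩ := b.exists_root_eq_sum_int i
  have h : P.rootSpanMem ℤ i = ∑ j : b.support, f j • b.toWeightBasisInt j := by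
    apply Subtype.ext
    rw [Submodule.coe_sum]
    simp only [Submodule.coe_smul, coe_toWeightBasisInt_apply]
    rw [Finset.sum_coe_sort b.support fun j ↦ f j • P.root j]
    exact hf
  induction y using QuotientAddGroup.induction_on with
  | H x =>
    rw [h, map_sum, rootRes_mk, rootVal_eq_sum b hf,
      ← Finset.sum_coe_sort b.support fun j ↦ f j * P.rootVal j x]
    push_cast
    refine Finset.sum_congr rfl fun j _ ↦ ?_
    rw [map_smul, residueHom, Basis.constr_basis, rootRes_mk, zsmul_eq_mul]

lemma Base.exists_forall_rootVal_eq (c : b.support → ℤ) :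
    ∃ x : P.coweightLattice, ∀ j : b.support, P.rootVal j x = c j := by
  obtain ⟨v, hv⟩ := b.exists_forall_root'_eq fun j ↦ (c j : ℝ)
  have hmem : v ∈ P.coweightLattice := fun i ↦ by
    obtain ⟨f, -, -, hf⟩ := b.exists_root_eq_sum_int i
    refine ⟨∑ j : b.support, f j * c j, ?_⟩
    rw [hf, ← Finset.sum_coe_sort b.support fun j ↦ f j • P.root j]
    simp only [map_sum, map_zsmul, LinearMap.coe_sum, Finset.sum_apply, LinearMap.smul_apply]
    push_cast
    refine Finset.sum_congr rfl fun j _ ↦ ?_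
    have := hv j
    rw [root'] at this
    rw [this, zsmul_eq_mul]
  refine ⟨⟨v, hmem⟩, fun j ↦ ?_⟩
  have h := P.coe_rootVal j ⟨v, hmem⟩
  rw [hv] at h
  exact_mod_cast h

lemma Base.residueHom_bijective {q : ℕ} (hq : 0 < q) : Function.Bijective (b.residueHom q) := by
  constructor
  · intro y y' h
    refine P.rootRes_ext hq fun i ↦ ?_
    rw [← b.residueHom_rootSpanMem, ← b.residueHom_rootSpanMem, h]
  · intro φ
    choose c hc using fun j : b.support ↦ ZMod.intCast_surjective (φ (b.toWeightBasisInt j))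
    obtain ⟨x, hx⟩ := b.exists_forall_rootVal_eq c
    refine ⟨QuotientAddGroup.mk x, b.toWeightBasisInt.ext fun j ↦ ?_⟩
    rw [residueHom, Basis.constr_basis, rootRes_mk, hx, hc]

/-- The relations on the root lattice satisfied by the points fixed by `w` at which the roots from
`S` vanish. -/
def relations (P : RootPairing ι ℝ M N) (w : P.weylGroup) (S : Finset ι) :
    Submodule ℤ (P.rootSpan ℤ) :=
  Submodule.span ℤ (Set.range (fun i ↦ P.rootSpanMem ℤ (P.weylPerm w i) - P.rootSpanMem ℤ i) ∪
    P.rootSpanMem ℤ '' S)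

/-- Arbitrary coefficients `A` let the same sublattice describe both the points modulo q and the
real fixed space, as `exists_card_annihilator` requires. -/
lemma forall_mem_relations_iff {A : Type*} [AddCommGroup A] (w : P.weylGroup) (S : Finset ι)
    (φ : P.rootSpan ℤ →ₗ[ℤ] A) :
    (∀ a ∈ relations P w S, φ a = 0) ↔
      (∀ i, φ (P.rootSpanMem ℤ (P.weylPerm w i)) = φ (P.rootSpanMem ℤ i)) ∧
        ∀ i ∈ S, φ (P.rootSpanMem ℤ i) = 0 := by
  have h1 : (∀ a ∈ relations P w S, φ a = 0) ↔ relations P w S ≤ LinearMap.ker φ := Iff.rfl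
  rw [h1, relations, Submodule.span_le, Set.union_subset_iff, Set.range_subset_iff,
    Set.image_subset_iff]
  refine and_congr (forall_congr' fun i ↦ ?_) Iff.rfl
  rw [SetLike.mem_coe, LinearMap.mem_ker, map_sub, sub_eq_zero]

/-- The number of points of `Z / q Z` fixed by `w` at which given roots vanish. -/
theorem Base.exists_card_fixed_vanishing (b : P.Base) (w : P.weylGroup) (S : Finset ι) :
    ∃ n : ℕ, 0 < n ∧ ∃ c : ℤ → ℕ, Function.Periodic c (n : ℤ) ∧ (∀ q, c (-q) = c q) ∧
      ∀ q : ℕ, 0 < q →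
        Nat.card {y : P.CoweightMod q // w • y = y ∧ ∀ i ∈ S, P.rootRes q i y = 0} =
          c q * q ^ finrank ℝ
            (P.fixedSpace w ⊓ ⨅ i ∈ S, LinearMap.ker (P.root' i) : Submodule ℝ N) := by
  obtain ⟨n, hn, c, hc, hc', h⟩ := exists_card_annihilator b.toWeightBasisInt b.realEquiv
    (relations P w S) (P.fixedSpace w ⊓ ⨅ i ∈ S, LinearMap.ker (P.root' i)) fun v ↦ by
      rw [forall_mem_relations_iff, Submodule.mem_inf, P.mem_fixedSpace_iff_forall]
      simp only [b.realEquiv_apply, Submodule.mem_iInf, LinearMap.mem_ker]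
  refine ⟨n, hn, c, hc, hc', fun q hq ↦ ?_⟩
  rw [← h q hq]
  refine Nat.card_congr ((Equiv.ofBijective _ (b.residueHom_bijective hq)).subtypeEquiv fun y ↦ ?_)
  rw [forall_mem_relations_iff, P.smul_eq_self_iff hq]
  simp only [Equiv.ofBijective_apply, b.residueHom_rootSpanMem]

end Base

end RootPairing

/-! ### Lattice points with an adjacent alcove -/

namespace RootPairing

variable {ι M N : Type*} [AddCommGroup M] [Module ℝ M] [AddCommGroup N] [Module ℝ N]
  (P : RootPairing ι ℝ M N)

section Cell

open Classical in
/-- The alcove of the arrangement dilated by `q` that is adjacent to the lattice point `x` and lies,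
among those, on the positive side exactly of the roots from `s`. -/
def cell (q : ℕ) (x : P.coweightLattice) (s : Finset ι) (i : ι) : ℤ :=
  P.rootVal i x / q - if (q : ℤ) ∣ P.rootVal i x ∧ i ∉ s then 1 else 0

open Classical in
/-- The roots that vanish at a point of `Z / q Z`. -/
def vanishing [Fintype ι] (q : ℕ) (y : P.CoweightMod q) : Finset ι :=
  Finset.univ.filter fun i ↦ P.rootRes q i y = 0

variable {P} {q : ℕ} {x : P.coweightLattice} {s : Finset ι}

lemma mem_vanishing_iff [Fintype ι] {y : P.CoweightMod q} {i : ι} :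
    i ∈ P.vanishing q y ↔ P.rootRes q i y = 0 := by
  simp [vanishing]

lemma mem_vanishing_mk_iff [Fintype ι] {i : ι} :
    i ∈ P.vanishing q (QuotientAddGroup.mk x) ↔ (q : ℤ) ∣ P.rootVal i x := by
  rw [mem_vanishing_iff, rootRes_mk_eq_zero_iff]

lemma cell_of_mem {i : ι} (hi : i ∈ s) : P.cell q x s i = P.rootVal i x / q := by
  rw [cell, if_neg fun h ↦ h.2 hi, sub_zero]

lemma cell_of_notMem {i : ι} (hd : (q : ℤ) ∣ P.rootVal i x) (hi : i ∉ s) :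
    P.cell q x s i = P.rootVal i x / q - 1 := by
  rw [cell, if_pos ⟨hd, hi⟩]

lemma cell_of_not_dvd {i : ι} (hd : ¬ (q : ℤ) ∣ P.rootVal i x) :
    P.cell q x s i = P.rootVal i x / q := by
  rw [cell, if_neg fun h ↦ hd h.1, sub_zero]

lemma cell_eq_iff (hq : 0 < q) {i : ι} {k : ℤ} : P.cell q x s i = k ↔
    (q * k < P.rootVal i x ∧ P.rootVal i x < q * (k + 1)) ∨
      (P.rootVal i x = q * k ∧ i ∈ s) ∨ (P.rootVal i x = q * (k + 1) ∧ i ∉ s) := by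
  classical
  have hq' : (0 : ℤ) < q := by exact_mod_cast hq
  by_cases hd : (q : ℤ) ∣ P.rootVal i x
  · have hcell : P.cell q x s i = P.rootVal i x / q - if i ∈ s then 0 else 1 := by
      split_ifs with h
      · rw [cell_of_mem h, sub_zero]
      · exact cell_of_notMem hd h
    obtain ⟨m, hm⟩ := hd
    rw [hcell, hm, Int.mul_ediv_cancel_left _ hq'.ne']
    simp only [mul_lt_mul_iff_right₀ hq', mul_right_inj' hq'.ne']
    by_cases his : i ∈ s
    · simp only [his, if_true, not_true, and_true, and_false, or_false]
      omega
    · simp only [his, if_false, not_false_iff, and_true, and_false, false_or]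
      omega
  · rw [cell_of_not_dvd hd]
    have h0 (m : ℤ) : P.rootVal i x ≠ q * m := fun h ↦ hd ⟨m, h⟩
    simp only [h0, false_and, or_false]
    rw [Int.ediv_eq_iff_of_pos hq']
    have h1 := h0 k
    constructor
    · rintro ⟨h2, h3⟩
      constructor
      · exact lt_of_le_of_ne (by linarith) (Ne.symm h1)
      · linarith
    · rintro ⟨h2, h3⟩
      constructor <;> linarith

lemma le_rootVal_of_cell (hq : 0 < q) (i : ι) : q * P.cell q x s i ≤ P.rootVal i x ∧
    P.rootVal i x ≤ q * (P.cell q x s i + 1) := by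
  have hq' : (0 : ℤ) < q := by exact_mod_cast hq
  rcases (cell_eq_iff (x := x) (s := s) (i := i) hq).1 rfl with ⟨h1, h2⟩ | ⟨h1, -⟩ | ⟨h1, -⟩
  · exact ⟨h1.le, h2.le⟩
  · rw [h1]
    constructor <;> linarith
  · rw [h1]
    constructor <;> linarith

lemma cell_add_nsmul (hq : 0 < q) (z : P.coweightLattice) (i : ι) :
    P.cell q (x + q • z) s i = P.cell q x s i + P.rootVal i z := by
  have h := (cell_eq_iff (x := x) (s := s) (i := i) hq).1 rfl
  rw [cell_eq_iff hq, map_add, map_nsmul, nsmul_eq_mul]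
  simpa only [mul_add, add_lt_add_iff_right, add_left_inj, add_right_comm _ _ (_ * (1 : ℤ))]
    using h

/-- If v ↦ wv + qz fixes the point and w preserves the chosen sides, then that map preserves the
adjacent alcove. -/
lemma cell_weylPerm (hq : 0 < q) {w : P.weylGroup} {z : P.coweightLattice}
    (hx : x = w • x + q • z) (hs : ∀ i, (q : ℤ) ∣ P.rootVal i x → (P.weylPerm w i ∈ s ↔ i ∈ s))
    (i : ι) : P.cell q x s (P.weylPerm w i) =
      P.cell q x s i + P.rootVal (P.weylPerm w i) z := by
  have e : P.rootVal (P.weylPerm w i) x = P.rootVal i x + q * P.rootVal (P.weylPerm w i) z := by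
    conv_lhs => rw [hx]
    rw [map_add, map_nsmul, rootVal_weylPerm_smul, nsmul_eq_mul]
  have h := (cell_eq_iff (x := x) (s := s) (i := i) hq).1 rfl
  rw [cell_eq_iff hq, e]
  rcases h with ⟨h1, h2⟩ | ⟨h1, h2⟩ | ⟨h1, h2⟩
  · left
    constructor <;> linarith
  · refine Or.inr (Or.inl ⟨by rw [mul_add]; linarith, (hs i (by rw [h1]; simp)).2 h2⟩)
  · refine Or.inr (Or.inr ⟨by linarith, mt (hs i (by rw [h1]; simp)).1 h2⟩)

variable [Fintype ι]

/-- For a point u of the region and small t > 0, x/q + tu lies inside: roots not vanishing modulo q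
stay in their open strip, and the others move off their wall to the side given by u. -/
lemma isAlcove_cell (hq : 0 < q) {U : Submodule ℝ N}
    (hs : s ∈ regions P.root' U (P.vanishing q (QuotientAddGroup.mk x))) :
    P.IsAlcove (P.cell q x s) := by
  have hq' : (0 : ℝ) < q := by exact_mod_cast hq
  obtain ⟨-, u, -, hu⟩ := hs
  have key : ∀ᶠ t : ℝ in nhdsWithin 0 (Set.Ioi 0), ∀ i,
      (P.cell q x s i : ℝ) < (q : ℝ)⁻¹ * P.rootVal i x + t * P.root' i u ∧
        (q : ℝ)⁻¹ * P.rootVal i x + t * P.root' i u < P.cell q x s i + 1 := by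
    rw [Filter.eventually_all]
    intro i
    have hc : Continuous fun t : ℝ ↦ (q : ℝ)⁻¹ * P.rootVal i x + t * P.root' i u := by fun_prop
    have ht : Filter.Tendsto (fun t : ℝ ↦ (q : ℝ)⁻¹ * P.rootVal i x + t * P.root' i u)
        (nhdsWithin 0 (Set.Ioi 0)) (nhds ((q : ℝ)⁻¹ * P.rootVal i x)) := by
      simpa using (hc.tendsto 0).mono_left nhdsWithin_le_nhds
    rcases (cell_eq_iff (x := x) (s := s) (i := i) hq).1 rfl with ⟨h1, h2⟩ | ⟨h1, h2⟩ | ⟨h1, h2⟩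
    · have h1' : (q : ℝ) * P.cell q x s i < P.rootVal i x := by exact_mod_cast h1
      have h2' : (P.rootVal i x : ℝ) < q * (P.cell q x s i + 1) := by exact_mod_cast h2
      rw [← lt_inv_mul_iff₀ hq'] at h1'
      rw [← inv_mul_lt_iff₀ hq'] at h2'
      exact (ht.eventually_const_lt h1').and (ht.eventually_lt_const h2')
    · have hpos : 0 < P.root' i u :=
        ((hu i (mem_vanishing_mk_iff.2 (by rw [h1]; simp))).2).1 h2
      have e : (q : ℝ)⁻¹ * P.rootVal i x = P.cell q x s i := by
        rw [h1]; push_cast; rw [inv_mul_cancel_left₀ hq'.ne']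
      rw [e] at ht ⊢
      filter_upwards [self_mem_nhdsWithin, ht.eventually_lt_const (lt_add_one _)] with t ht0 ht1
      exact ⟨by linarith [mul_pos ht0 hpos], ht1⟩
    · have hneg : P.root' i u < 0 := by
        have := hu i (mem_vanishing_mk_iff.2 (by rw [h1]; simp))
        exact lt_of_le_of_ne (not_lt.mp (mt this.2.2 h2)) this.1
      have e : (q : ℝ)⁻¹ * P.rootVal i x = P.cell q x s i + 1 := by
        rw [h1]; push_cast; rw [inv_mul_cancel_left₀ hq'.ne']
      rw [e] at ht ⊢
      filter_upwards [self_mem_nhdsWithin, ht.eventually_const_lt (lt_add_one _)] with t ht0 ht1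
      exact ⟨ht1, by linarith [mul_neg_of_pos_of_neg ht0 hneg]⟩
  obtain ⟨t, ht⟩ := key.exists
  refine ⟨(q : ℝ)⁻¹ • (x : N) + t • u, fun i ↦ ?_⟩
  rw [map_add, map_smul, map_smul, ← coe_rootVal, smul_eq_mul, smul_eq_mul]
  exact ht i

lemma weylPerm_mem_iff_of_mem_regions [P.IsRootSystem] {w : P.weylGroup} (hq : 0 < q)
    (hx : w • (QuotientAddGroup.mk x : P.CoweightMod q) = QuotientAddGroup.mk x)
    (hs : s ∈ regions P.root' (P.fixedSpace w) (P.vanishing q (QuotientAddGroup.mk x)))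
    {i : ι} (hi : (q : ℤ) ∣ P.rootVal i x) : P.weylPerm w i ∈ s ↔ i ∈ s := by
  obtain ⟨-, u, hu, h⟩ := hs
  have h1 := (P.smul_eq_self_iff hq).1 hx i
  have h2 := mem_vanishing_mk_iff.2 hi
  rw [(h i h2).2, (h _ (mem_vanishing_iff.2 (h1.trans (mem_vanishing_iff.1 h2)))).2,
    P.mem_fixedSpace_iff_forall.1 hu]

end Cell

/-- A lift to `Z` of a fixed point of `w` on `Z / q Z` is moved by a vector from `q Z`. -/
lemma smul_mk_eq_iff {q : ℕ} {w : P.weylGroup} {x : P.coweightLattice} :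
    w • (QuotientAddGroup.mk x : P.CoweightMod q) = QuotientAddGroup.mk x ↔
      ∃ z, x = w • x + q • z :=
  P.mk_eq_mk_iff (x := w • x)

/-! ### The bijection -/

section Bijection

variable {P} [Fintype ι] [P.IsRootSystem] [P.IsCrystallographic] [P.IsReduced] [P.IsIrreducible]
  (b : P.Base)

open Classical in
/-- The shift vector of an alcove. -/
def Base.shift (k : ι → ℤ) : P.coweightLattice :=
  if h : ∃ ρ, P.IsShift b.coxeterNumber k ρ then h.choose else 0

lemma Base.isShift_shift {k : ι → ℤ} (hk : P.IsAlcove k) :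
    P.IsShift b.coxeterNumber k (b.shift k) := by
  have h := b.exists_isShift hk
  rw [shift, dif_pos h]
  exact h.choose_spec

lemma IsAlcove.add {k : ι → ℤ} (hk : P.IsAlcove k) (z : P.coweightLattice) :
    P.IsAlcove fun i ↦ k i + P.rootVal i z := by
  obtain ⟨p, hp⟩ := hk
  refine ⟨p + z, fun i ↦ ?_⟩
  rw [map_add, ← coe_rootVal]
  push_cast
  constructor <;> linarith [(hp i).1, (hp i).2]

lemma Base.shift_add {k k' : ι → ℤ} (hk : P.IsAlcove k) (z : P.coweightLattice)
    (h : ∀ i, k' i = k i + P.rootVal i z) :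
    b.shift k' = b.shift k + b.coxeterNumber • z := by
  obtain rfl : k' = fun i ↦ k i + P.rootVal i z := funext h
  have := IsShift.eq_smul_add 1 z (fun i ↦ rfl) (b.isShift_shift hk) (b.isShift_shift (hk.add z))
  rwa [one_smul] at this

lemma Base.shift_weyl {k : ι → ℤ} (hk : P.IsAlcove k) {w : P.weylGroup} {z : P.coweightLattice}
    (h : ∀ i, k (P.weylPerm w i) = k i + P.rootVal (P.weylPerm w i) z) :
    b.shift k = w • b.shift k + b.coxeterNumber • z :=
  IsShift.eq_smul_add w z h (b.isShift_shift hk) (b.isShift_shift hk)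

variable {q h : ℕ} {w : P.weylGroup}

lemma Base.rootVal_add_shift_cell (hq : 0 < q) (hh : (h : ℤ) = b.coxeterNumber)
    {x : P.coweightLattice} {s : Finset ι} {U : Submodule ℝ N}
    (hs : s ∈ regions P.root' U (P.vanishing q (QuotientAddGroup.mk x))) (i : ι) :
    ((q + h : ℕ) : ℤ) * P.cell q x s i < P.rootVal i (x + b.shift (P.cell q x s)) ∧
    P.rootVal i (x + b.shift (P.cell q x s)) < ((q + h : ℕ) : ℤ) * (P.cell q x s i + 1) := by
  have := (b.isShift_shift (isAlcove_cell hq hs) q x).1 (fun i ↦ le_rootVal_of_cell hq i) i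
  rw [← hh] at this
  exact_mod_cast this

lemma not_dvd_of_lt_of_lt {d a k : ℤ} (hd : 0 < d) (h1 : d * k < a) (h2 : a < d * (k + 1)) :
    ¬ d ∣ a := by
  rintro ⟨m, rfl⟩
  have h3 := lt_of_mul_lt_mul_left h1 hd.le
  have h4 := lt_of_mul_lt_mul_left h2 hd.le
  omega

lemma eq_of_mul_lt_of_lt_mul {d a k k' : ℤ} (hd : 0 < d) (h1 : d * k < a) (h2 : a < d * (k + 1))
    (h1' : d * k' < a) (h2' : a < d * (k' + 1)) : k = k' := by
  have h3 := lt_of_mul_lt_mul_left (h1.trans h2') hd.le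
  have h4 := lt_of_mul_lt_mul_left (h1'.trans h2) hd.le
  omega

/-- The lattice points of `Z / q Z` together with an adjacent alcove, both fixed by `w`, correspond
to the fixed points of `w` in the complement of the arrangement modulo `q + h`. -/
theorem Base.card_sigma_regions (hq : 0 < q) (hh : (h : ℤ) = b.coxeterNumber) :
    Nat.card (Σ y : {y : P.CoweightMod q // w • y = y},
      regions P.root' (P.fixedSpace w) (P.vanishing q y.1)) =
    Nat.card {y : P.CoweightMod (q + h) // w • y = y ∧ ∀ i, P.rootRes (q + h) i y ≠ 0} := by
  have hqh : (0 : ℤ) < (q + h : ℕ) := by exact_mod_cast Nat.add_pos_left hq h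
  -- Moving the lattice point by qz moves its shift by hz; together they give a translation by
  -- (q+h)z, so the map descends from qZ to (q+h)Z.
  have hsm (z : P.coweightLattice) : (q + h) • z = q • z + b.coxeterNumber • z := by
    rw [← hh, natCast_zsmul, add_nsmul]
  have hmk (y : P.CoweightMod q) : (QuotientAddGroup.mk y.out : P.CoweightMod q) = y :=
    Quotient.out_eq _
  have hout (y : {y : P.CoweightMod q // w • y = y})
      (s : regions P.root' (P.fixedSpace w) (P.vanishing q y.1)) :
      s.1 ∈ regions P.root' (P.fixedSpace w) (P.vanishing q (QuotientAddGroup.mk y.1.out)) := by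
    rw [hmk]; exact s.2
  let lift : (Σ y : {y : P.CoweightMod q // w • y = y},
      regions P.root' (P.fixedSpace w) (P.vanishing q y.1)) → P.coweightLattice := fun a ↦
    a.1.1.out + b.shift (P.cell q a.1.1.out a.2.1)
  have hlift (a) : w • (QuotientAddGroup.mk (lift a) : P.CoweightMod (q + h)) =
      QuotientAddGroup.mk (lift a) ∧
        ∀ i, P.rootRes (q + h) i (QuotientAddGroup.mk (lift a)) ≠ 0 := by
    obtain ⟨y, s⟩ := a
    have hs := hout y s
    constructor
    · have hy : w • (QuotientAddGroup.mk y.1.out : P.CoweightMod q) =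
          QuotientAddGroup.mk y.1.out := by rw [hmk]; exact y.2
      obtain ⟨z, hz⟩ := P.smul_mk_eq_iff.1 hy
      refine P.smul_mk_eq_iff.2 ⟨z, ?_⟩
      have h1 := b.shift_weyl (isAlcove_cell hq hs) (cell_weylPerm hq hz fun i hi ↦
        weylPerm_mem_iff_of_mem_regions hq hy hs hi)
      simp only [lift]
      rw [hsm, smul_add, add_add_add_comm, ← hz, ← h1]
    · intro i hi
      have h1 := b.rootVal_add_shift_cell hq hh hs i
      exact not_dvd_of_lt_of_lt hqh h1.1 h1.2 (P.rootRes_mk_eq_zero_iff.1 hi)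
  refine Nat.card_congr (Equiv.ofBijective (fun a ↦ ⟨QuotientAddGroup.mk (lift a), hlift a⟩)
    ⟨?_, ?_⟩)
  · rintro ⟨y, s⟩ ⟨y', s'⟩ heq
    obtain ⟨z, hz⟩ := P.mk_eq_mk_iff.1 (congrArg Subtype.val heq)
    have hs := hout y s
    have hs' := hout y' s'
    -- A point in the open (q+h)-fold dilate of an alcove determines that alcove, so equal images
    -- force the cells to agree up to z.
    have hcell (i : ι) : P.cell q y'.1.out s'.1 i = P.cell q y.1.out s.1 i + P.rootVal i z := by
      have h1 := b.rootVal_add_shift_cell hq hh hs i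
      have h2 := b.rootVal_add_shift_cell hq hh hs' i
      have h3 : P.rootVal i (y'.1.out + b.shift (P.cell q y'.1.out s'.1)) =
          P.rootVal i (y.1.out + b.shift (P.cell q y.1.out s.1)) + (q + h : ℕ) * P.rootVal i z := by
        have := congrArg (P.rootVal i) hz
        rw [map_add _ (lift ⟨y, s⟩), map_nsmul, nsmul_eq_mul] at this
        exact this
      refine eq_of_mul_lt_of_lt_mul hqh h2.1 h2.2 ?_ ?_ <;> rw [h3] <;> linarith [h1.1, h1.2]
    have hsh := b.shift_add (isAlcove_cell hq hs) z hcell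
    have hz' : y'.1.out = y.1.out + q • z := by
      simp only [lift] at hz
      rw [hsh, hsm, add_add_add_comm] at hz
      exact add_right_cancel hz
    obtain rfl : y = y' := by
      refine Subtype.ext ?_
      rw [← hmk y.1, ← hmk y'.1]
      exact P.mk_eq_mk_iff.2 ⟨z, hz'⟩
    have hz0 (i : ι) : P.rootVal i z = 0 := by
      have h1 := congrArg (P.rootVal i) hz'
      rw [map_add, map_nsmul, nsmul_eq_mul] at h1
      have h2 : (q : ℤ) * P.rootVal i z = 0 := by linarith
      exact (mul_eq_zero.mp h2).resolve_left (by exact_mod_cast hq.ne')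
    have hss : s = s' := by
      refine Subtype.ext (Finset.ext fun i ↦ ?_)
      have hi := hcell i
      rw [hz0, add_zero] at hi
      by_cases hd : (q : ℤ) ∣ P.rootVal i y.1.out
      · by_cases h1 : i ∈ s.1 <;> by_cases h2 : i ∈ s'.1
        · exact iff_of_true h1 h2
        · rw [cell_of_mem h1, cell_of_notMem hd h2] at hi
          omega
        · rw [cell_of_mem h2, cell_of_notMem hd h1] at hi
          omega
        · exact iff_of_false h1 h2
      · rw [← mem_vanishing_mk_iff] at hd
        exact iff_of_false (fun h ↦ hd (hs.1 h)) fun h ↦ hd (hs'.1 h)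
    rw [hss]
  · rintro ⟨y', hy', hreg⟩
    induction y' using QuotientAddGroup.induction_on with
    | H Y =>
    obtain ⟨z, hz⟩ := P.smul_mk_eq_iff.1 hy'
    -- Surjectivity: off the walls, floors give the alcove of Y/(q+h); subtracting its shift yields
    -- a lattice point of the closed q-fold dilate.
    set k : ι → ℤ := fun i ↦ P.rootVal i Y / (q + h : ℕ) with hk
    have hkY (i : ι) : ((q + h : ℕ) : ℤ) * k i < P.rootVal i Y ∧
        P.rootVal i Y < ((q + h : ℕ) : ℤ) * (k i + 1) := by
      have h1 : ¬ ((q + h : ℕ) : ℤ) ∣ P.rootVal i Y := fun h ↦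
        hreg i (P.rootRes_mk_eq_zero_iff.2 h)
      have h2 := Int.emod_add_mul_ediv (P.rootVal i Y) (q + h : ℕ)
      have h3 := Int.emod_lt_of_pos (P.rootVal i Y) hqh
      have h4 := Int.emod_nonneg (P.rootVal i Y) hqh.ne'
      have h5 : P.rootVal i Y % (q + h : ℕ) ≠ 0 := fun h ↦ h1 (Int.dvd_of_emod_eq_zero h)
      have h6 : 0 < P.rootVal i Y % (q + h : ℕ) := lt_of_le_of_ne h4 h5.symm
      constructor <;> linarith
    have hqhr : (0 : ℝ) < (q + h : ℕ) := by exact_mod_cast hqh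
    have hqr : (0 : ℝ) < q := by exact_mod_cast hq
    have hkp (i : ι) : (k i : ℝ) < P.root' i (((q + h : ℕ) : ℝ)⁻¹ • (Y : N)) ∧
        P.root' i (((q + h : ℕ) : ℝ)⁻¹ • (Y : N)) < k i + 1 := by
      rw [map_smul, ← coe_rootVal, smul_eq_mul, lt_inv_mul_iff₀ hqhr, inv_mul_lt_iff₀ hqhr]
      exact_mod_cast hkY i
    have hkA : P.IsAlcove k := ⟨_, hkp⟩
    have hρ := b.isShift_shift hkA
    set x : P.coweightLattice := Y - b.shift k with hx
    have hxk : ∀ i, q * k i ≤ P.rootVal i x ∧ P.rootVal i x ≤ q * (k i + 1) := by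
      refine (hρ q x).2 fun i ↦ ?_
      rw [hx, sub_add_cancel, ← hh]
      exact_mod_cast hkY i
    have hkw (i : ι) : k (P.weylPerm w i) = k i + P.rootVal (P.weylPerm w i) z := by
      have e : P.rootVal (P.weylPerm w i) Y =
          P.rootVal i Y + (q + h : ℕ) * P.rootVal (P.weylPerm w i) z := by
        conv_lhs => rw [hz]
        rw [map_add, map_nsmul, rootVal_weylPerm_smul, nsmul_eq_mul]
      simp only [hk, e]
      rw [Int.add_mul_ediv_left _ _ hqh.ne']
    have hxz : x = w • x + q • z := by
      have h1 := b.shift_weyl hkA hkw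
      have h2 : x = (w • Y + (q • z + b.coxeterNumber • z)) -
          (w • b.shift k + b.coxeterNumber • z) := by
        rw [← hsm, ← hz, ← h1]
      have h3 : w • x = w • Y - w • b.shift k := by rw [hx, smul_sub]
      rw [h3]
      refine h2.trans ?_
      abel
    have hyfix : w • (QuotientAddGroup.mk x : P.CoweightMod q) = QuotientAddGroup.mk x :=
      P.smul_mk_eq_iff.2 ⟨z, hxz⟩
    classical
    set s : Finset ι := Finset.univ.filter fun i ↦ P.rootVal i x = q * k i with hs
    have hmem (i : ι) : i ∈ s ↔ P.rootVal i x = q * k i := by simp [hs]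
    have hcase (i : ι) (hd : (q : ℤ) ∣ P.rootVal i x) :
        P.rootVal i x = q * k i ∨ P.rootVal i x = q * (k i + 1) := by
      obtain ⟨m, hm⟩ := hd
      have h1 := hxk i
      rw [hm] at h1 ⊢
      have hq0 : (0 : ℤ) < q := by exact_mod_cast hq
      have h2 := le_of_mul_le_mul_left h1.1 hq0
      have h3 := le_of_mul_le_mul_left h1.2 hq0
      rcases (by omega : m = k i ∨ m = k i + 1) with rfl | rfl
      · exact Or.inl rfl
      · exact Or.inr rfl
    have hsreg : s ∈ regions P.root' (P.fixedSpace w) (P.vanishing q (QuotientAddGroup.mk x)) := by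
      -- The witness Y/(q+h) - x/q points from x/q into the alcove, so its signs detect which wall x
      -- is on. It is fixed by w because w moves both terms by -z.
      refine ⟨fun i hi ↦ mem_vanishing_mk_iff.2 ⟨k i, (hmem i).1 hi⟩,
        ((q + h : ℕ) : ℝ)⁻¹ • (Y : N) - (q : ℝ)⁻¹ • (x : N), ?_, fun i hi ↦ ?_⟩
      · rw [mem_fixedSpace_iff]
        have e1 : P.weylAct w (Y : N) = (Y : N) - ((q + h : ℕ) : ℝ) • (z : N) := by
          rw [← coe_smul_coweightLattice, Nat.cast_smul_eq_nsmul]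
          conv_rhs => rw [hz]
          rw [AddSubgroup.coe_add, AddSubgroup.coe_nsmul, add_sub_cancel_right]
        have e2 : P.weylAct w (x : N) = (x : N) - (q : ℝ) • (z : N) := by
          rw [← coe_smul_coweightLattice, Nat.cast_smul_eq_nsmul]
          conv_rhs => rw [hxz]
          rw [AddSubgroup.coe_add, AddSubgroup.coe_nsmul, add_sub_cancel_right]
        rw [map_sub, map_smul, map_smul, e1, e2, smul_sub, smul_sub, inv_smul_smul₀ hqhr.ne',
          inv_smul_smul₀ hqr.ne']
        abel
      · have e : P.root' i ((q : ℝ)⁻¹ • (x : N)) = (q : ℝ)⁻¹ * P.rootVal i x := by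
          rw [map_smul, ← coe_rootVal, smul_eq_mul]
        rw [hmem, map_sub, e]
        have h1 := hkp i
        generalize P.root' i (((q + h : ℕ) : ℝ)⁻¹ • (Y : N)) = r at h1 ⊢
        rcases hcase i (mem_vanishing_mk_iff.1 hi) with h2 | h2
        · rw [h2]
          push_cast
          rw [inv_mul_cancel_left₀ hqr.ne']
          refine ⟨by linarith [h1.1], by simp only [true_iff]; linarith [h1.1]⟩
        · have h3 : ¬ P.rootVal i x = q * k i := by
            rw [h2]
            intro h4
            have : (q : ℤ) = 0 := by linarith
            exact hq.ne' (by exact_mod_cast this)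
          rw [iff_false_left h3, h2]
          push_cast
          rw [inv_mul_cancel_left₀ hqr.ne']
          refine ⟨by linarith [h1.2], by linarith [h1.2]⟩
    have hcellk (i : ι) : P.cell q x s i = k i := by
      rw [cell_eq_iff hq, hmem]
      by_cases h1 : P.rootVal i x = q * k i
      · exact Or.inr (Or.inl ⟨h1, h1⟩)
      · by_cases h2 : P.rootVal i x = q * (k i + 1)
        · exact Or.inr (Or.inr ⟨h2, h1⟩)
        · exact Or.inl ⟨lt_of_le_of_ne (hxk i).1 (Ne.symm h1), lt_of_le_of_ne (hxk i).2 h2⟩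
    refine ⟨⟨⟨QuotientAddGroup.mk x, hyfix⟩, ⟨s, hsreg⟩⟩, Subtype.ext ?_⟩
    simp only [lift]
    -- The representative used by `lift` may differ from x by qζ, which changes the image by (q+h)ζ
    -- only.
    obtain ⟨ζ, hζ⟩ := P.mk_eq_mk_iff.1 (hmk (QuotientAddGroup.mk x)).symm
    refine (P.mk_eq_mk_iff.2 ⟨ζ, ?_⟩).symm
    rw [hζ, b.shift_add hkA ζ fun i ↦ ?_, hsm, hx]
    · abel
    · rw [cell_add_nsmul hq, hcellk]

end Bijection

end RootPairing

/-! ### The equivariant characteristic quasi-polynomial -/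

namespace RootPairing

variable {ι M N : Type*} [AddCommGroup M] [Module ℝ M] [AddCommGroup N] [Module ℝ N]
  {P : RootPairing ι ℝ M N}

lemma permChar_eq_card (q : ℕ) (w : P.weylGroup) : P.permChar q w =
    Nat.card {y : P.CoweightMod q // w • y = y ∧ ∀ i, P.rootRes q i y ≠ 0} := by
  rw [permChar]
  congr 1
  refine Nat.card_congr
    { toFun := fun y ↦ ⟨y.1.1, congrArg Subtype.val y.2, P.mem_complement_iff.1 y.1.2⟩
      invFun := fun y ↦ ⟨⟨y.1, P.mem_complement_iff.2 y.2.2⟩, Subtype.ext y.2.1⟩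
      left_inv := fun _ ↦ rfl
      right_inv := fun _ ↦ rfl }

/-! ### Inclusion–exclusion over the vanishing roots -/

section Count

variable [Fintype ι] [P.IsRootSystem] {q : ℕ}

open Classical in
/-- Interchanging the summation over fixed points and over sets of vanishing roots. -/
lemma sum_card_mul_eq_sum_vanishing [Fintype (P.CoweightMod q)] (w : P.weylGroup)
    (g : Finset ι → ℤ) :
    ∑ S : Finset ι, g S *
        (Nat.card {y : P.CoweightMod q // w • y = y ∧ ∀ i ∈ S, P.rootRes q i y = 0} : ℤ) =
      ∑ y : {y : P.CoweightMod q // w • y = y}, ∑ S ∈ (P.vanishing q y.1).powerset, g S := by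
  have h1 (y : P.CoweightMod q) : ∑ S ∈ (P.vanishing q y).powerset, g S =
      ∑ S : Finset ι, if ∀ i ∈ S, P.rootRes q i y = 0 then g S else 0 := by
    rw [← Finset.sum_filter]
    refine Finset.sum_congr (Finset.ext fun S ↦ ?_) fun _ _ ↦ rfl
    simp [Finset.subset_iff, mem_vanishing_iff]
  simp_rw [h1]
  rw [Finset.sum_comm]
  refine Finset.sum_congr rfl fun S _ ↦ ?_
  rw [← Finset.sum_filter, Finset.sum_const, nsmul_eq_mul, mul_comm, ← Fintype.card_subtype,
    ← Nat.card_eq_fintype_card]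
  congr 2
  exact (Nat.card_congr (Equiv.subtypeSubtypeEquivSubtypeInter (fun y : P.CoweightMod q ↦ w • y = y)
    fun y ↦ ∀ i ∈ S, P.rootRes q i y = 0)).symm

/-- The alternating sum over subsets of the vanishing roots of a point is 1 if none vanish and 0
otherwise. -/
lemma card_complement_eq_sum (hq : 0 < q) (w : P.weylGroup) :
    (Nat.card {y : P.CoweightMod q // w • y = y ∧ ∀ i, P.rootRes q i y ≠ 0} : ℤ) =
      ∑ S : Finset ι, (-1 : ℤ) ^ S.card *
        (Nat.card {y : P.CoweightMod q // w • y = y ∧ ∀ i ∈ S, P.rootRes q i y = 0} : ℤ) := by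
  classical
  have := P.finite_coweightMod hq
  have := Fintype.ofFinite (P.CoweightMod q)
  rw [sum_card_mul_eq_sum_vanishing]
  simp_rw [Finset.sum_powerset_neg_one_pow_card]
  rw [← Finset.sum_filter, Finset.sum_const, nsmul_eq_mul, mul_one, ← Fintype.card_subtype,
    ← Nat.card_eq_fintype_card]
  congr 1
  rw [← Nat.card_congr (Equiv.subtypeSubtypeEquivSubtypeInter
    (fun y : P.CoweightMod q ↦ w • y = y) fun y ↦ ∀ i, P.rootRes q i y ≠ 0)]
  refine Nat.card_congr (Equiv.subtypeEquivRight fun y ↦ ?_)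
  simp [Finset.eq_empty_iff_forall_notMem, mem_vanishing_iff]

variable [P.IsCrystallographic] [P.IsReduced] [P.IsIrreducible]

/-- Reciprocity for the signed count of the fixed points. -/
lemma Base.sum_neg_one_pow_finrank_mul_card (b : P.Base) (hq : 0 < q) {h : ℕ}
    (hh : (h : ℤ) = b.coxeterNumber) (w : P.weylGroup) :
    ∑ S : Finset ι, ((-1 : ℤ) ^ S.card * (-1) ^ finrank ℝ
          (P.fixedSpace w ⊓ ⨅ i ∈ S, LinearMap.ker (P.root' i) : Submodule ℝ N)) *
        (Nat.card {y : P.CoweightMod q // w • y = y ∧ ∀ i ∈ S, P.rootRes q i y = 0} : ℤ) =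
      (-1) ^ P.fixedDim w *
        (Nat.card {y : P.CoweightMod (q + h) // w • y = y ∧ ∀ i, P.rootRes (q + h) i y ≠ 0} : ℤ) := by
  classical
  have := P.finite_coweightMod hq
  have := Fintype.ofFinite (P.CoweightMod q)
  have : FiniteDimensional ℝ N := b.toCoweightBasis.finiteDimensional_of_finite
  have hfin (y : {y : P.CoweightMod q // w • y = y}) :
      Finite (regions P.root' (P.fixedSpace w) (P.vanishing q y.1)) :=
    (finite_regions P.root' (P.fixedSpace w) (P.vanishing q y.1)).to_subtype
  rw [sum_card_mul_eq_sum_vanishing, ← b.card_sigma_regions hq hh, Nat.card_sigma]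
  simp_rw [sum_neg_one_pow_finrank_eq_ncard_regions]
  rw [← Finset.mul_sum]
  push_cast
  rfl

end Count

/-! ### Existence, reciprocity at negative integers and uniqueness -/

section Main

variable [Finite ι] [P.IsRootSystem] [P.IsCrystallographic] [P.IsReduced] [P.IsIrreducible]

/-- The quasi-polynomial exists, and its values at negative integers are given by those at positive
integers. -/
theorem Base.exists_isEquivariantCharQuasiPoly (b : P.Base) : ∃ X : ℤ → P.weylGroup → ℂ,
    P.IsEquivariantCharQuasiPoly X ∧ ∀ q : ℕ, 0 < q → ∀ w,
      X (-q) w = (-1) ^ P.fixedDim w * X (q + b.coxeterNumber) w := by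
  classical
  have := Fintype.ofFinite ι
  choose n hn c hc hc' hcard using fun w S ↦ b.exists_card_fixed_vanishing w S
  set d : P.weylGroup → Finset ι → ℕ := fun w S ↦ finrank ℝ
    (P.fixedSpace w ⊓ ⨅ i ∈ S, LinearMap.ker (P.root' i) : Submodule ℝ N) with hd
  let X : ℤ → P.weylGroup → ℂ := fun q w ↦
    ∑ S : Finset ι, (-1 : ℂ) ^ S.card * ((c w S q : ℂ) * (q : ℂ) ^ d w S)
  have hX : ∀ q : ℕ, 0 < q → ∀ w, X q w = P.permChar q w := by
    intro q hq w
    have h := card_complement_eq_sum hq w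
    rw [permChar_eq_card]
    have h' := congrArg (fun a : ℤ ↦ (a : ℂ)) h
    simp only [Int.cast_natCast] at h'
    rw [h']
    simp only [X, hcard w _ q hq]
    push_cast
    rfl
  refine ⟨X, ⟨isQuasiPolynomial_of_forall fun w ↦ ?_, hX⟩, fun q hq w ↦ ?_⟩
  · have h := IsQuasiPoly.sum Finset.univ fun S _ ↦
      (IsQuasiPoly.mul_pow (hn w S) (hc w S) (d w S)).const_mul ((-1) ^ S.card)
    convert h using 1
    ext q
    simp [X]
  · obtain ⟨h, hh⟩ := Int.eq_ofNat_of_zero_le b.coxeterNumber_pos.le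
    have e1 : X (q + b.coxeterNumber) w = P.permChar (q + h) w := by
      rw [hh, ← hX (q + h) (Nat.add_pos_left hq h)]
      push_cast
      rfl
    have h1 := congrArg (fun a : ℤ ↦ (a : ℂ))
      (b.sum_neg_one_pow_finrank_mul_card hq hh.symm w)
    rw [e1, permChar_eq_card]
    push_cast at h1
    rw [← h1]
    -- Evenness of `c` leaves only the sign (-1)^d from (-q)^d, so X at -q is the signed count of
    -- `Base.sum_neg_one_pow_finrank_mul_card`.
    simp only [X, hcard w _ q hq, hc']
    refine Finset.sum_congr rfl fun S _ ↦ ?_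
    push_cast
    rw [neg_pow]
    ring

lemma IsEquivariantCharQuasiPoly.unique {X X' : ℤ → P.weylGroup → ℂ}
    (hX : P.IsEquivariantCharQuasiPoly X) (hX' : P.IsEquivariantCharQuasiPoly X') : X = X' := by
  ext q w
  exact congrFun ((hX.1.isQuasiPoly w).ext_of_pos (hX'.1.isQuasiPoly w) fun q hq ↦ by
    rw [hX.2 q hq, hX'.2 q hq]) q

end Main

end RootPairing

end

theorem theorem4p6 {ι M N : Type*} [Finite ι]
    [AddCommGroup M] [Module ℝ M] [AddCommGroup N] [Module ℝ N]
    (P : RootPairing ι ℝ M N) [P.IsRootSystem] [P.IsCrystallographic] [P.IsReduced]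
    [P.IsIrreducible] (b : P.Base) :
    (∃! X : ℤ → P.weylGroup → ℂ, P.IsEquivariantCharQuasiPoly X) ∧
    ∀ X : ℤ → P.weylGroup → ℂ, P.IsEquivariantCharQuasiPoly X →
      ∀ (q : ℤ) (w : P.weylGroup),
        X q w = (-1) ^ Module.finrank ℝ N * P.delta w * X (b.coxeterNumber - q) w := by
  obtain ⟨X₀, hX₀, hrec⟩ := b.exists_isEquivariantCharQuasiPoly
  refine ⟨⟨X₀, hX₀, fun X hX ↦ hX.unique hX₀⟩, fun X hX q w ↦ ?_⟩
  obtain rfl := hX.unique hX₀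
  have hqp := hX.1.isQuasiPoly w
  -- Both sides are quasi-polynomials in q, so reciprocity at positive q extends to all integers.
  have key : (fun q ↦ X (-q) w) =
      fun q ↦ (((-1) ^ P.fixedDim w : ℚ) : ℂ) * X (q + b.coxeterNumber) w :=
    hqp.comp_neg.ext_of_pos ((hqp.comp_add b.coxeterNumber).const_mul _) fun q hq ↦ by
      simp [hrec q hq w]
  have h := congrFun key (-q)
  simp only [neg_neg] at h
  have : FiniteDimensional ℝ N := b.toCoweightBasis.finiteDimensional_of_finite
  have hle : P.fixedDim w ≤ Module.finrank ℝ N := Submodule.finrank_le _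
  -- ℓ + (ℓ - r(w)) has the parity of r(w); `hle` is needed because the exponent in `delta` uses
  -- truncated subtraction.
  have hsign : (-1 : ℂ) ^ Module.finrank ℝ N * P.delta w = (-1) ^ P.fixedDim w := by
    obtain ⟨m, hm⟩ := Nat.exists_eq_add_of_le hle
    rw [RootPairing.delta, hm, Nat.add_sub_cancel_left, pow_add, mul_assoc, ← mul_pow]
    simp
  rw [hsign, h, neg_add_eq_sub]
  simp
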